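/- Let $d\ge1$, $\Omega=(0,1)^d$. Let $\mathrm P:[0,\infty)\to\mathbb R$ be continuous, strictly increasing, and smooth on $(0,\infty)$. Let $h:[0,\infty)\to\mathbb R$ be continuous, $C^2$ on $(0,\infty)$, with $\mathrm P'(r)=r\,h''(r)$ for all $r>0$ and $h(0)=0$. Put $h_*(s)=s\,h(1/s)$ for $s>0$ and $h_*(0)=\lim_{s\downarrow0}h_*(s)\in(-\infty,+\infty]$, and assume McCann's condition that $z\mapsto h_*(z^d)$ is convex on $(0,\infty)$. Let $V:\Omega\to\mathbb R$ be smooth with $\nabla^2V\ge\lambda\mathbb 1$ on $\Omega$ for some $\lambda\in\mathbb R$, and let $\bar u\ge0$ be an integrable density on $\Omega$ of total mass $M$. For a finite measure $\nu$ on $\Omega$ with Lebesgue decomposition $\nu=u\,dx+\nu^\perp$ put $$\mathbb E(\nu)=\int_\Omega h(u)\,dx+h_*(0)\,\nu^\perp(\Omega)+\int_\Omega V\,d\nu\in(-\infty,+\infty]$$ (so $\mathbb E(u)=\int_\Omega h(u)\,dx+\int_\Omega uV\,dx$ on densities; $h_*(0)=+\infty$ if $h$ grows superlinearly; $h_*(0)\cdot0=0$),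 and $\mathbf E(\mathfrak S)=\mathbb E(\mathfrak S_\#\bar u)$, where $\mathfrak S_\#\bar u$ is the push-forward of the measure $\bar u\,dx$ on $\Omega$. Let $\mathrm{Diff}^+$ be the set of orientation-preserving $C^1$-diffeomorphisms of $\overline\Omega$ onto itself that fix the corners. Let $\mathfrak X$ be the set of convex functions $\phi:\overline\Omega\to\mathbb R$ with $\nabla\phi(x)\in\Omega$ for almost every $x\in\Omega$, and $\nabla\mathfrak X$ the set of maps $\mathfrak t$ that agree a.e. on $\Omega$ with $\nabla\phi$ for some $\phi\in\mathfrak X$. Then for every $\mathfrak T\in\mathrm{Diff}^+$, the functional $\mathfrak t\mapsto\mathbf E(\mathfrak t\circ\mathfrak T)$ is $\lambda$-convex on $\nabla\mathfrak X$ in the flat sense with respect to $L^2(\mathfrak T_\#\bar u)$: the set $\nabla\mathfrak X$ is convex, every $\mathfrak t\in\nabla\mathfrak X$ lies in $L^2(\mathfrak T_\#\bar u)$ with $\mathbf E(\mathfrak t\circ\mathfrak T)\in(-\infty,+\infty]$, and for all $\mathfrak t_0,\mathfrak t_1\in\nabla\mathfrak X$ and $s\in[0,1]$, $$\mathbf E\big(((1-s)\mathfrak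 t_0+s\mathfrak t_1)\circ\mathfrak T\big)\le(1-s)\,\mathbf E(\mathfrak t_0\circ\mathfrak T)+s\,\mathbf E(\mathfrak t_1\circ\mathfrak T)-\frac\lambda2\,s(1-s)\,\|\mathfrak t_1-\mathfrak t_0\|_{L^2(\mathfrak T_\#\bar u)}^2,$$ with the convention $0\cdot(+\infty)=0$. -/

import Mathlib

open Set Filter Topology MeasureTheory
open scoped ENNReal ContDiff

noncomputable section

namespace FokkerPlanck

/-- `d`-dimensional Euclidean space. -/
abbrev Space (d : ℕ) : Type := EuclideanSpace ℝ (Fin d)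

/-- The open unit cube `Ω = (0,1)^d`. -/
def cube (d : ℕ) : Set (Space d) := {x | ∀ i, 0 < x i ∧ x i < 1}

/-- The closed unit cube, i.e. the closure of `Ω`. -/
def closedCube (d : ℕ) : Set (Space d) := {x | ∀ i, 0 ≤ x i ∧ x i ≤ 1}

/-- Non-negative densities on `Ω` of total mass `M`. -/
structure IsDensity (d : ℕ) (M : ℝ) (u : Space d → ℝ) : Prop where
  integrableOn : IntegrableOn u (cube d)
  nonneg : ∀ x ∈ cube d, 0 ≤ u x
  mass : ∫ x in cube d, u x = M

/-- The measure `u dx` on `Ω`. -/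
def densityMeasure (d : ℕ) (u : Space d → ℝ) : Measure (Space d) :=
  (volume.restrict (cube d)).withDensity fun x => ENNReal.ofReal (u x)

/-- The push-forward measure `T_# u` of the measure `u dx` on `Ω`. -/
def pushForward (d : ℕ) (u : Space d → ℝ) (T : Space d → Space d) : Measure (Space d) :=
  (densityMeasure d u).map T

/-- The class `Diff⁺`: orientation preserving `C¹`-diffeomorphisms of the closed cube onto itself
that fix the corners. Values of `T` outside the closed cube are irrelevant. -/
structure IsDiffPlus (d : ℕ) (T : Space d → Space d) : Prop where
  bijOn : BijOn T (closedCube d) (closedCube d)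
  contDiffOn : ContDiffOn ℝ 1 T (closedCube d)
  contDiffOn_inv : ∃ S : Space d → Space d,
    InvOn S T (closedCube d) (closedCube d) ∧ ContDiffOn ℝ 1 S (closedCube d)
  det_pos : ∀ x ∈ closedCube d, 0 < (fderivWithin ℝ T (closedCube d) x).det
  corners : ∀ x : Space d, (∀ i, x i = 0 ∨ x i = 1) → T x = x

/-- The set `𝔛` of convex functions `φ` on the closed cube with `∇φ(Ω) ⊆ Ω`. A convex function need
not be differentiable everywhere, so `∇φ(x) ∈ Ω` is required for almost every `x ∈ Ω`. -/
def potentials (d : ℕ) : Set (Space d → ℝ) :=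
  {φ | ConvexOn ℝ (closedCube d) φ ∧
    ∀ᵐ x ∂volume.restrict (cube d), DifferentiableAt ℝ φ x ∧ gradient φ x ∈ cube d}

/-- The set `∇𝔛` of maps that coincide a.e. on `Ω` with the gradient of some `φ ∈ 𝔛`. -/
def gradPotentials (d : ℕ) : Set (Space d → Space d) :=
  {t | ∃ φ ∈ potentials d, t =ᵐ[volume.restrict (cube d)] gradient φ}

/-- `h_*(s) = s h(1/s)`, for `s > 0`. -/
def hStar (h : ℝ → ℝ) (s : ℝ) : ℝ := s * h (1 / s)

/-- The value `h_*(0) = lim_{s ↓ 0} h_*(s) = lim_{r → ∞} h(r)/r`, possibly `+∞`. For convex `h`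
with `h(0) = 0` the limit exists, by monotonicity. -/
def hStarZero (h : ℝ → ℝ) : EReal :=
  limsup (fun s : ℝ => ((hStar h s : ℝ) : EReal)) (𝓝[>] 0)

/-- The extended integral `∫ f⁺ - ∫ f⁻`. If the first is infinite and the second is finite,
this is `+∞`. -/
def extIntegral {α : Type*} [MeasurableSpace α] (μ : Measure α) (f : α → ℝ) : EReal :=
  ((∫⁻ x, ENNReal.ofReal (f x) ∂μ : ℝ≥0∞) : EReal)
    - ((∫⁻ x, ENNReal.ofReal (-f x) ∂μ : ℝ≥0∞) : EReal)

/-- The relative entropy functional on finite measures `ν` on `Ω`. If `ν` has the density `u`, this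
is `∫_Ω h(u) dx + ∫_Ω u V dx`. A part of `ν` which is singular with respect to Lebesgue measure
contributes its mass times `h_*(0)`, which is `+∞` if `h` grows superlinearly. -/
def entropy (d : ℕ) (h : ℝ → ℝ) (V : Space d → ℝ) (ν : Measure (Space d)) : EReal :=
  extIntegral (volume.restrict (cube d)) (fun x => h (ν.rnDeriv volume x).toReal)
    + hStarZero h * ((ν.singularPart volume (cube d) : ℝ≥0∞) : EReal)
    + extIntegral (ν.restrict (cube d)) V

/-- The Lagrangian functional `T ↦ 𝐄(T) = 𝔼(T_# ū)`. -/
def lagrangianEntropy (d : ℕ) (h : ℝ → ℝ) (V : Space d → ℝ) (ubar : Space d → ℝ)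
    (T : Space d → Space d) : EReal :=
  entropy d h V (pushForward d ubar T)

/-- `P` is an admissible pressure function: continuous on `[0,∞)`, smooth on `(0,∞)`,
and strictly increasing. -/
structure IsPressure (P : ℝ → ℝ) : Prop where
  continuousOn : ContinuousOn P (Ici 0)
  contDiffOn : ContDiffOn ℝ ∞ P (Ioi 0)
  strictMonoOn : StrictMonoOn P (Ici 0)

/-- `h` is the internal energy density of the pressure `P`: `P'(r) = r h''(r)` for all `r > 0`.
Of the free affine function, the constant is fixed by `h(0) = 0`. -/
structure IsEnergyDensity (P h : ℝ → ℝ) : Prop where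
  continuousOn : ContinuousOn h (Ici 0)
  contDiffOn : ContDiffOn ℝ 2 h (Ioi 0)
  deriv_eq : ∀ r : ℝ, 0 < r → deriv P r = r * deriv (deriv h) r
  zero : h 0 = 0

/-- McCann's condition in dimension `d`: `z ↦ h_*(z^d)` is convex on `(0,∞)`. -/
def McCannCondition (d : ℕ) (h : ℝ → ℝ) : Prop :=
  ConvexOn ℝ (Ioi 0) fun z : ℝ => hStar h (z ^ d)

/-- `V` is smooth on `Ω`, with `∇²V ≥ lam 𝟙`. -/
structure IsPotential (d : ℕ) (lam : ℝ) (V : Space d → ℝ) : Prop where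
  contDiffOn : ContDiffOn ℝ ∞ V (cube d)
  hessian_ge : ∀ x ∈ cube d, ∀ v : Space d,
    lam * ‖v‖ ^ 2 ≤ iteratedFDeriv ℝ 2 V x ![v, v]

/-- `F`, with values in `(-∞,+∞]`, is `lam`-convex in the flat sense on the set `K` of maps,
with respect to the `L²(μ)`-norm: `K` is convex, and along linear interpolations,
`F((1-s) t₀ + s t₁) ≤ (1-s) F(t₀) + s F(t₁) - (lam/2) s (1-s) ‖t₁ - t₀‖²_{L²(μ)}`. -/
def FlatConvexOn {d : ℕ} (lam : ℝ) (μ : Measure (Space d)) (K : Set (Space d → Space d))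
    (F : (Space d → Space d) → EReal) : Prop :=
  Convex ℝ K ∧ (∀ t ∈ K, F t ≠ ⊥ ∧ MemLp t 2 μ) ∧
    ∀ t₀ ∈ K, ∀ t₁ ∈ K, ∀ s ∈ Icc (0 : ℝ) 1,
      F ((1 - s) • t₀ + s • t₁) ≤
        ((1 - s : ℝ) : EReal) * F t₀ + (s : EReal) * F t₁
          - ((lam / 2 * s * (1 - s) * ∫ x, ‖t₁ x - t₀ x‖ ^ 2 ∂μ : ℝ) : EReal)

end FokkerPlanck

end

open FokkerPlanck

noncomputable section

namespace FokkerPlanck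

open scoped RealInnerProductSpace

/-! This is McCann's displacement convexity argument, carried out in Lagrangian coordinates. Put
$\mu=\mathfrak T_\#\bar u$. Since $\mathfrak T^{-1}$ is $C^1$, it preserves null sets, so $\mu$ has
a density $f$ on the cube and $\mathbf E(\mathfrak t\circ\mathfrak T)=\mathbb E(\mathfrak t_\#\mu)$.
Everything then takes place on a fixed measure space.

A gradient $\mathfrak t$ of a convex function is differentiable, relative to a set $D$ of full
measure, with a symmetric positive semidefinite derivative $A$ (a form of Alexandrov's theorem).
Where $\det A>0$ the map $\mathfrak t$ is injective, and the area formula gives $\det A\cdot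
u(\mathfrak t)=f$ for the density $u$ of the push-forward. Where $\det A=0$ the image is a null set,
so the mass found there is exactly the singular part. As $m\,h(f/m)=f\,h_*(m/f)$, both parts combine
into $$\mathbb E(\mathfrak t_\#\mu)=\int f\,h_*(\det A/f)\,dx+\int V(\mathfrak t)\,d\mu,$$ the value
$h_*(0)$ accounting for the singular mass (`entropy_map`, `entropy_map_eq_integral`).

Along $(1-s)\mathfrak t_0+s\mathfrak t_1$ the derivative is $(1-s)A_0+sA_1$. By Minkowski's
determinant inequality $\det^{1/d}$ is concave on positive semidefinite matrices
(`concave_rpow_det`). Convexity of $h$ with $h(0)=0$ makes $h_*$ nonincreasing, and McCann's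
condition makes $z\mapsto h_*(z^d)$ convex, so the first integrand is convex in $s$ pointwise. The
second is $\lambda$-convex because $V$ is. Integration gives the claim when both end values are
finite. Otherwise the right side is $+\infty$, since the entropy never equals $-\infty$. -/

/-- `t` is a selection of subgradients of `φ` on the set `D`. -/
def IsSubgradOn {E : Type*} [NormedAddCommGroup E] [InnerProductSpace ℝ E] (φ : E → ℝ) (t : E → E)
    (D : Set E) : Prop :=
  ∀ x ∈ D, ∀ y ∈ D, φ x + ⟪t x, y - x⟫ ≤ φ y

/-! ### Subgradients: monotonicity and continuity -/

section Subgradient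

variable {E : Type*} [NormedAddCommGroup E] [InnerProductSpace ℝ E]

theorem _root_.ConvexOn.add_fderiv_le {s : Set E} {φ : E → ℝ} (hφ : ConvexOn ℝ s φ) {L : E →L[ℝ] ℝ}
    {x y : E} (hx : x ∈ s) (hy : y ∈ s) (hL : HasFDerivAt φ L x) : φ x + L (y - x) ≤ φ y := by
  have hc : ConvexOn ℝ (AffineMap.lineMap x y ⁻¹' s) (φ ∘ AffineMap.lineMap (k := ℝ) x y) :=
    hφ.comp_affineMap _
  have hd : HasDerivAt (φ ∘ AffineMap.lineMap (k := ℝ) x y) (L (y - x)) 0 := by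
    have h1 : HasDerivAt (AffineMap.lineMap (k := ℝ) x y) (y - x) 0 := AffineMap.hasDerivAt_lineMap
    have h2 : HasFDerivAt φ L (AffineMap.lineMap (k := ℝ) x y 0) := by simpa using hL
    exact h2.comp_hasDerivAt 0 h1
  have h := hc.le_slope_of_hasDerivAt (x := 0) (y := 1) (by simpa using hx) (by simpa using hy)
    one_pos hd
  simp [slope_def_field] at h
  linarith [map_sub L y x]

theorem IsSubgradOn.mono {φ : E → ℝ} {t : E → E} {D D' : Set E} (h : IsSubgradOn φ t D)
    (hD : D' ⊆ D) : IsSubgradOn φ t D' := fun x hx y hy => h x (hD hx) y (hD hy)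

theorem IsSubgradOn.monotone {φ : E → ℝ} {t : E → E} {D : Set E} (h : IsSubgradOn φ t D)
    {x y : E} (hx : x ∈ D) (hy : y ∈ D) : 0 ≤ ⟪t y - t x, y - x⟫ := by
  have h1 := h x hx y hy
  have h2 := h y hy x hx
  rw [← neg_sub y x, inner_neg_right] at h2
  rw [inner_sub_left]
  linarith

theorem IsSubgradOn.convexCombination {φ₀ φ₁ : E → ℝ} {t₀ t₁ : E → E} {D : Set E}
    (h₀ : IsSubgradOn φ₀ t₀ D) (h₁ : IsSubgradOn φ₁ t₁ D) {a b : ℝ} (ha : 0 ≤ a) (hb : 0 ≤ b) :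
    IsSubgradOn (fun x => a * φ₀ x + b * φ₁ x) (a • t₀ + b • t₁) D := by
  intro x hx y hy
  have e0 := mul_le_mul_of_nonneg_left (h₀ x hx y hy) ha
  have e1 := mul_le_mul_of_nonneg_left (h₁ x hx y hy) hb
  simp only [Pi.add_apply, Pi.smul_apply, inner_add_left, real_inner_smul_left]
  linarith

/-- Subgradients converge to the gradient at points of differentiability. -/
theorem continuousWithinAt_of_subgrad {φ : E → ℝ} {t : E → E} {s D : Set E}
    (hs : IsOpen s) (h : ∀ x ∈ D, ∀ y ∈ s, φ x + ⟪t x, y - x⟫ ≤ φ y) (hD : D ⊆ s)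
    {x : E} (hx : x ∈ D) (hd : HasFDerivAt φ (innerSL ℝ (t x)) x) : ContinuousWithinAt t D x := by
  rw [Metric.continuousWithinAt_iff]
  intro ε hε
  have h1 := hd.isLittleO.def (show (0 : ℝ) < ε / 4 by positivity)
  obtain ⟨r, hr, hball⟩ := Metric.eventually_nhds_iff_ball.1
    (h1.and (hs.mem_nhds (hD hx)))
  refine ⟨r / 4, by positivity, fun {z} hz hzx => ?_⟩
  by_contra hcon
  push Not at hcon
  rw [dist_eq_norm] at hcon hzx
  set v := t z - t x with hv
  have hvpos : 0 < ‖v‖ := hε.trans_le hcon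
  -- Testing at distance `r / 2` from `x` in the direction of `v` gives `r / 2 * ‖v‖`, of which `z`
  -- within `r / 4` costs at most half. The remaining `r / 4 * ‖v‖` is at most `ε * r / 8`,
  -- contradicting `ε ≤ ‖v‖`.
  set y := x + (r / 2 / ‖v‖) • v with hy
  have hyx : ‖y - x‖ = r / 2 := by
    rw [hy, add_sub_cancel_left, norm_smul, Real.norm_of_nonneg (by positivity)]
    field_simp
  have hyb : y ∈ Metric.ball x r := by
    rw [Metric.mem_ball, dist_eq_norm, hyx]; linarith
  obtain ⟨hy1, hy2⟩ := hball y hyb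
  rw [hyx, Real.norm_eq_abs] at hy1
  have hy1' := (abs_le.1 hy1).2
  simp only [innerSL_apply_apply] at hy1'
  have a1 := h z hz y hy2
  have a2 := h x hx z (hD hz)
  have e1 : ⟪t z, y - z⟫ = ⟪v, y - x⟫ + ⟪t x, y - x⟫ - ⟪v, z - x⟫ - ⟪t x, z - x⟫ := by
    rw [hv]; simp only [inner_sub_left, inner_sub_right]; ring
  have e2 : ⟪v, y - x⟫ = r / 2 * ‖v‖ := by
    rw [hy, add_sub_cancel_left, real_inner_smul_right, real_inner_self_eq_norm_sq]
    field_simp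
  have e3 : ⟪v, z - x⟫ ≤ ‖v‖ * (r / 4) :=
    (real_inner_le_norm _ _).trans (mul_le_mul_of_nonneg_left hzx.le (norm_nonneg _))
  nlinarith

/-- Monotonicity of `t` makes the cross term in the expanded square nonnegative, so `id + t` is
expansive and its inverse is 1-Lipschitz. -/
theorem IsSubgradOn.norm_sub_le {φ : E → ℝ} {t : E → E} {D : Set E} (h : IsSubgradOn φ t D)
    {x y : E} (hx : x ∈ D) (hy : y ∈ D) : ‖x - y‖ ≤ ‖(x + t x) - (y + t y)‖ := by
  have h1 := h.monotone hy hx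
  have e : (x + t x) - (y + t y) = (x - y) + (t x - t y) := by abel
  rw [e]
  refine le_of_sq_le_sq ?_ (norm_nonneg _)
  rw [norm_add_sq_real, real_inner_comm]
  nlinarith [sq_nonneg ‖t x - t y‖]

end Subgradient

/-! ### Blow-up at a point: injectivity, symmetry and positivity -/

section Blowup

variable {E : Type*} [NormedAddCommGroup E] [InnerProductSpace ℝ E]

/-- `D` is only dense near `x`, so it may miss the ray `x + w / n`. A point of `D` within `1 / n ^
2` of it is good enough, the error after rescaling by `n` being `1 / n`. -/
theorem exists_seq_blowup {D : Set E} {x : E} (hx : closure D ∈ 𝓝 x) (w : E) :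
    ∃ z : ℕ → E, (∀ᶠ n in atTop, z n ∈ D) ∧
      Tendsto (fun n : ℕ => (n : ℝ) • (z n - x)) atTop (𝓝 w) := by
  have key : ∀ᶠ n : ℕ in atTop, ∃ z ∈ D, ‖z - (x + (n : ℝ)⁻¹ • w)‖ < ((n : ℝ) ^ 2)⁻¹ := by
    have h1 : Tendsto (fun n : ℕ => x + (n : ℝ)⁻¹ • w) atTop (𝓝 x) := by
      have : Tendsto (fun n : ℕ => (n : ℝ)⁻¹ • w) atTop (𝓝 ((0 : ℝ) • w)) :=
        tendsto_inv_atTop_nhds_zero_nat.smul_const w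
      simpa using this.const_add x
    filter_upwards [h1.eventually hx, eventually_gt_atTop 0] with n hn hn0
    obtain ⟨z, hz, hzd⟩ := Metric.mem_closure_iff.1 hn ((n : ℝ) ^ 2)⁻¹ (by positivity)
    exact ⟨z, hz, by rwa [← dist_eq_norm, dist_comm]⟩
  choose! z hz hzn using fun (n : ℕ) (hn : ∃ z ∈ D, ‖z - (x + (n : ℝ)⁻¹ • w)‖ < ((n : ℝ) ^ 2)⁻¹) =>
    hn
  refine ⟨z, key.mono hz, ?_⟩
  rw [tendsto_iff_norm_sub_tendsto_zero]
  refine squeeze_zero' (Eventually.of_forall fun _ => norm_nonneg _) ?_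
    tendsto_inv_atTop_nhds_zero_nat
  filter_upwards [key, eventually_gt_atTop 0] with n hn hn0
  have hn' : (0 : ℝ) < n := by exact_mod_cast hn0
  have e : (n : ℝ) • (z n - x) - w = (n : ℝ) • (z n - (x + (n : ℝ)⁻¹ • w)) := by
    rw [← sub_sub, smul_sub _ (z n - x), smul_smul, mul_inv_cancel₀ hn'.ne', one_smul]
  rw [e, norm_smul, Real.norm_of_nonneg hn'.le]
  calc (n : ℝ) * _ ≤ n * ((n : ℝ) ^ 2)⁻¹ := by gcongr; exact (hzn n hn).le
    _ = (n : ℝ)⁻¹ := by field_simp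

theorem tendsto_blowup_zero {z : ℕ → E} {x w : E}
    (h : Tendsto (fun n : ℕ => (n : ℝ) • (z n - x)) atTop (𝓝 w)) :
    Tendsto (fun n => z n - x) atTop (𝓝 0) := by
  have := (tendsto_inv_atTop_nhds_zero_nat (𝕜 := ℝ)).smul h
  rw [zero_smul] at this
  refine this.congr' ?_
  filter_upwards [eventually_gt_atTop 0] with n hn
  have hn' : (0 : ℝ) < n := by exact_mod_cast hn
  rw [smul_smul, inv_mul_cancel₀ hn'.ne', one_smul]

theorem tendsto_blowup_apply {D : Set E} {t : E → E} {A : E →L[ℝ] E} {z : ℕ → E} {x w : E}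
    (hA : HasFDerivWithinAt t A D x) (hz : ∀ᶠ n in atTop, z n ∈ D)
    (h : Tendsto (fun n : ℕ => (n : ℝ) • (z n - x)) atTop (𝓝 w)) :
    Tendsto (fun n : ℕ => (n : ℝ) • (t (z n) - t x)) atTop (𝓝 (A w)) := by
  have := hA.lim (c := fun n : ℕ => (n : ℝ)) (d := fun n => z n - x) (tendsto_blowup_zero h)
    (by simpa using hz) h
  simpa using this

/-- A monotone map with invertible derivative at `x` does not take the value `t x` again. -/
theorem IsSubgradOn.eq_of_apply_eq [FiniteDimensional ℝ E] {φ : E → ℝ} {t : E → E} {D : Set E}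
    (h : IsSubgradOn φ t D)
    {x y : E} (hx : closure D ∈ 𝓝 x) (hy : y ∈ D) {A : E →L[ℝ] E}
    (hA : HasFDerivWithinAt t A D x) (hdet : A.det ≠ 0) (hxy : t x = t y) : x = y := by
  -- Monotonicity between `y` and points approaching `x` in direction `w`, rescaled; the
  -- zeroth-order term drops out because `t x = t y`.
  have key : ∀ w, 0 ≤ ⟪A w, x - y⟫ := by
    intro w
    obtain ⟨z, hz, hzw⟩ := exists_seq_blowup hx w
    have h1 := tendsto_blowup_apply hA hz hzw
    have h2 : Tendsto (fun n => z n - y) atTop (𝓝 (x - y)) := by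
      have := (tendsto_blowup_zero hzw).add_const (x - y)
      simpa using this
    refine ge_of_tendsto (h1.inner h2) ?_
    filter_upwards [hz] with n hn
    rw [real_inner_smul_left, hxy]
    exact mul_nonneg (Nat.cast_nonneg n) (h.monotone hy hn)
  have hsurj : Function.Surjective A := by
    have := (LinearMap.equivOfDetNeZero (A : E →ₗ[ℝ] E) hdet).surjective
    exact this
  obtain ⟨w, hw⟩ := hsurj (-(x - y))
  have := key w
  rw [hw, inner_neg_left, real_inner_self_eq_norm_sq] at this
  have h0 : ‖x - y‖ = 0 := by nlinarith [sq_nonneg ‖x - y‖]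
  exact sub_eq_zero.1 (norm_eq_zero.1 h0)

/-- The derivative of a gradient of a convex function is symmetric and positive. -/
theorem IsSubgradOn.isPositive [FiniteDimensional ℝ E] {φ : E → ℝ} {t : E → E} {D : Set E}
    (h : IsSubgradOn φ t D) {x : E} (hxD : x ∈ D) (hx : closure D ∈ 𝓝 x) {A : E →L[ℝ] E}
    (hA : HasFDerivWithinAt t A D x) : (A : E →ₗ[ℝ] E).IsPositive := by
  choose z hz hzw using fun w => exists_seq_blowup hx w
  have hA' := fun w => tendsto_blowup_apply hA (hz w) (hzw w)
  -- The first-order remainder of `φ` at `x`, rescaled to second order; its limit plays the role of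
  -- the quadratic form of the Hessian.
  let g : E → ℕ → ℝ := fun w n => (n : ℝ) ^ 2 * (φ (z w n) - φ x - ⟪t x, z w n - x⟫)
  have hdiff : ∀ w y, Tendsto (fun n : ℕ => ⟪(n : ℝ) • (t (z w n) - t x),
      (n : ℝ) • (z y n - x) - (n : ℝ) • (z w n - x)⟫) atTop (𝓝 ⟪A w, y - w⟫) := fun w y =>
    (hA' w).inner ((hzw y).sub (hzw w))
  have hle : ∀ w y, ∀ᶠ n : ℕ in atTop, g w n + ⟪(n : ℝ) • (t (z w n) - t x),
      (n : ℝ) • (z y n - x) - (n : ℝ) • (z w n - x)⟫ ≤ g y n := by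
    intro w y
    filter_upwards [hz w, hz y] with n hn hn'
    have h1 := h _ hn _ hn'
    have e : ⟪t (z w n), z y n - z w n⟫ = ⟪t (z w n) - t x, (z y n - x) - (z w n - x)⟫
        + ⟪t x, z y n - x⟫ - ⟪t x, z w n - x⟫ := by
      simp only [inner_sub_left, inner_sub_right]; ring
    rw [← smul_sub, real_inner_smul_left, real_inner_smul_right]
    simp only [g]
    have h2 : (φ (z w n) - φ x - ⟪t x, z w n - x⟫)
        + ⟪t (z w n) - t x, (z y n - x) - (z w n - x)⟫ ≤ φ (z y n) - φ x - ⟪t x, z y n - x⟫ := by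
      linarith
    nlinarith [mul_le_mul_of_nonneg_left h2 (sq_nonneg (n : ℝ))]
  have hbdd : ∀ w, ∃ q, Tendsto (g w) (hyperfilter ℕ) (𝓝 q) := by
    intro w
    have hg0 : ∀ᶠ n in atTop, 0 ≤ g w n := by
      filter_upwards [hz w] with n hn
      have := h x hxD _ hn
      exact mul_nonneg (sq_nonneg _) (by linarith)
    have hg1 : ∀ᶠ n in atTop, g w n ≤ ⟪A w, w⟫ + 1 := by
      have hlim : Tendsto (fun n : ℕ => ⟪(n : ℝ) • (t (z w n) - t x), (n : ℝ) • (z w n - x)⟫) atTop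
        (𝓝 ⟪A w, w⟫) := (hA' w).inner (hzw w)
      filter_upwards [hz w, hlim.eventually (gt_mem_nhds (lt_add_one _))] with n hn hn'
      refine le_trans ?_ hn'.le
      have h1 := h _ hn _ hxD
      rw [real_inner_smul_left, real_inner_smul_right]
      simp only [g]
      rw [← mul_assoc, ← sq]
      refine mul_le_mul_of_nonneg_left ?_ (sq_nonneg _)
      rw [← neg_sub, inner_neg_right] at h1
      rw [inner_sub_left]
      linarith
    have hmem : ∀ᶠ n in (hyperfilter ℕ : Filter ℕ), g w n ∈ Icc 0 (⟪A w, w⟫ + 1) := by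
      have : (hyperfilter ℕ : Filter ℕ) ≤ atTop := by
        rw [← Nat.cofinite_eq_atTop]; exact hyperfilter_le_cofinite
      exact this (hg0.and hg1)
    -- Boundedness alone gives no limit, but one ultrafilter selects limits for all directions at
    -- once, so inequalities between different directions survive.
    obtain ⟨q, -, hq⟩ := isCompact_Icc.ultrafilter_le_nhds ((hyperfilter ℕ).map (g w))
      (le_principal_iff.2 hmem)
    exact ⟨q, hq⟩
  choose q hq using hbdd
  have hhyp : (hyperfilter ℕ : Filter ℕ) ≤ atTop := by
    rw [← Nat.cofinite_eq_atTop]; exact hyperfilter_le_cofinite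
  have hqle : ∀ w y, q w + ⟪A w, y - w⟫ ≤ q y := fun w y =>
    le_of_tendsto_of_tendsto ((hq w).add ((hdiff w y).mono_left hhyp)) (hq y) (hhyp (hle w y))
  -- Using `hqle` in both orders, the remainder of `q` at `w` lies between `0` and `‖A‖ * ‖y - w‖ ^
  -- 2`. So `q` has gradient `A w` at every `w`, and symmetry of second derivatives makes `A`
  -- symmetric.
  have hder : ∀ w, HasFDerivAt q (innerSL ℝ (A w)) w := by
    intro w
    refine .of_isLittleO <| Asymptotics.IsBigO.trans_isLittleO (g := fun y => ‖y - w‖ ^ 2) ?_ ?_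
    · refine Asymptotics.IsBigO.of_bound ‖A‖ (Eventually.of_forall fun y => ?_)
      have h1 := hqle w y
      have h2 := hqle y w
      have e : ⟪A y, w - y⟫ = - ⟪A w, y - w⟫ - ⟪A (y - w), y - w⟫ := by
        rw [map_sub, inner_sub_left, ← neg_sub y w, inner_neg_right]; ring
      have h3 : ⟪A (y - w), y - w⟫ ≤ ‖A‖ * ‖y - w‖ ^ 2 := by
        calc _ ≤ ‖A (y - w)‖ * ‖y - w‖ := real_inner_le_norm _ _
          _ ≤ ‖A‖ * ‖y - w‖ * ‖y - w‖ := by gcongr; exact A.le_opNorm _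
          _ = _ := by ring
      rw [innerSL_apply_apply, Real.norm_eq_abs, Real.norm_eq_abs, abs_of_nonneg (by linarith),
        abs_of_nonneg (by positivity)]
      linarith
    · have : Tendsto (fun y => y - w) (𝓝 w) (𝓝 0) := by
        have := ((continuous_id (X := E)).sub (continuous_const (y := w))).tendsto w
        simpa [Pi.sub_def] using this
      exact (Asymptotics.isLittleO_norm_pow_id one_lt_two).comp_tendsto this
  have hsymm : ∀ v w, ⟪A v, w⟫ = ⟪A w, v⟫ := by
    intro v w
    let B : E →ₗ[ℝ] E →L[ℝ] ℝ :=
      { toFun := fun w => innerSL ℝ (A w)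
        map_add' := fun v w => by ext; simp
        map_smul' := fun c w => by ext; simp }
    exact second_derivative_symmetric (f := q) (f' := fun w => innerSL ℝ (A w))
      (f'' := B.toContinuousLinearMap) (x := 0) hder B.toContinuousLinearMap.hasFDerivAt v w
  refine ⟨fun v w => ?_, fun w => ?_⟩
  · rw [ContinuousLinearMap.coe_coe, hsymm, real_inner_comm]
  · have h1 := hqle w 0
    have h2 := hqle 0 w
    simp at h1 h2
    simp
    linarith

end Blowup

/-! ### Almost everywhere differentiability of convex gradients -/

section Differentiability

variable {E : Type*} [NormedAddCommGroup E] [InnerProductSpace ℝ E] [FiniteDimensional ℝ E]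
  [MeasurableSpace E] [BorelSpace E]

/-- Haar measure and the Hausdorff measure of full dimension have the same null sets, and Lipschitz
maps preserve null sets of the latter. -/
theorem _root_.LipschitzOnWith.addHaar_image_eq_zero (μ : Measure E) [μ.IsAddHaarMeasure]
    {K : NNReal} {f : E → E} {s : Set E} (hf : LipschitzOnWith K f s) (hs : μ s = 0) :
    μ (f '' s) = 0 := by
  have h1 : μ ≪ μH[Module.finrank ℝ E] := Measure.absolutelyContinuous_isAddHaarMeasure _ _
  have h2 : μH[Module.finrank ℝ E] ≪ μ := Measure.absolutelyContinuous_isAddHaarMeasure _ _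
  refine h1 (le_antisymm ?_ zero_le)
  refine (hf.hausdorffMeasure_image_le (Nat.cast_nonneg _)).trans ?_
  rw [h2 hs, mul_zero]

/-- The gradient of a convex function is differentiable almost everywhere. The proof uses that
`id + ∇φ` is expansive, so that its inverse is differentiable by Rademacher's theorem. -/
theorem exists_hasFDerivWithinAt_of_subgrad (μ : Measure E) [μ.IsAddHaarMeasure] {φ : E → ℝ}
    {t : E → E} {s D : Set E} (hs : IsOpen s)
    (h : ∀ x ∈ D, ∀ y ∈ s, φ x + ⟪t x, y - x⟫ ≤ φ y) (hD : D ⊆ s)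
    (hd : ∀ x ∈ D, HasFDerivAt φ (innerSL ℝ (t x)) x) :
    ∃ N, μ N = 0 ∧ ∀ x ∈ D \ N, ∃ A : E →L[ℝ] E, HasFDerivWithinAt t A D x := by
  have hsub : IsSubgradOn φ t D := fun x hx y hy => h x hx y (hD hy)
  set W : E → E := fun x => x + t x with hW
  have hinj : InjOn W D := fun x hx y hy hxy => by
    have := hsub.norm_sub_le hx hy
    rw [show x + t x = y + t y from hxy, sub_self, norm_zero] at this
    exact sub_eq_zero.1 (norm_le_zero_iff.1 this)
  by_cases hne : Nonempty E
  swap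
  · exact ⟨∅, measure_empty, fun x => (hne ⟨x⟩).elim⟩
  set R : E → E := Function.invFunOn W D with hR
  have hRW : ∀ x ∈ D, R (W x) = x := fun x hx => hinj.leftInvOn_invFunOn hx
  have hLip : LipschitzOnWith 1 R (W '' D) := by
    refine LipschitzOnWith.of_dist_le_mul ?_
    rintro _ ⟨x, hx, rfl⟩ _ ⟨y, hy, rfl⟩
    rw [hRW x hx, hRW y hy, NNReal.coe_one, one_mul, dist_eq_norm, dist_eq_norm]
    exact hsub.norm_sub_le hx hy
  -- The inverse function theorem can fail for `R` in two ways: no derivative (null by Rademacher,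
  -- and `R` is Lipschitz), or a singular derivative (null image by Sard).
  set N₁ := {y ∈ W '' D | ¬ DifferentiableWithinAt ℝ R (W '' D) y} with hN₁
  set N₂ := {y ∈ W '' D | DifferentiableWithinAt ℝ R (W '' D) y ∧
    (fderivWithin ℝ R (W '' D) y).det = 0} with hN₂
  have h1 : μ (R '' N₁) = 0 := by
    refine (hLip.mono (sep_subset _ _)).addHaar_image_eq_zero μ ?_
    have := hLip.ae_differentiableWithinAt_of_mem (μ := μ)
    rw [ae_iff] at this
    convert this using 2
    ext y; exact Classical.not_imp.symm
  have h2 : μ (R '' N₂) = 0 :=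
    addHaar_image_eq_zero_of_det_fderivWithin_eq_zero μ
      (fun y hy => hy.2.1.hasFDerivWithinAt.mono (sep_subset _ _)) fun y hy => hy.2.2
  refine ⟨R '' N₁ ∪ R '' N₂, measure_union_null h1 h2, ?_⟩
  rintro x ⟨hx, hxN⟩
  have hWx : W x ∈ W '' D := mem_image_of_mem _ hx
  have hdiff : DifferentiableWithinAt ℝ R (W '' D) (W x) := by
    by_contra hcon
    exact hxN (Or.inl ⟨W x, ⟨hWx, hcon⟩, hRW x hx⟩)
  have hdet : (fderivWithin ℝ R (W '' D) (W x)).det ≠ 0 := fun hcon =>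
    hxN (Or.inr ⟨W x, ⟨hWx, hdiff, hcon⟩, hRW x hx⟩)
  set B := ContinuousLinearMap.toContinuousLinearEquivOfDetNeZero _ hdet with hB
  have hcont : ContinuousWithinAt W D x :=
    continuousWithinAt_id.add (continuousWithinAt_of_subgrad hs h hD hx (hd x hx))
  have hWd : HasFDerivWithinAt W (B.symm : E →L[ℝ] E) D x := by
    refine HasFDerivWithinAt.of_local_left_inverse (f := R) (t := W '' D) ?_ ?_ hx ?_
    · exact hcont.tendsto_nhdsWithin (mapsTo_image W D)
    · exact hdiff.hasFDerivWithinAt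
    · filter_upwards [self_mem_nhdsWithin] with y hy using hRW y hy
  refine ⟨(B.symm : E →L[ℝ] E) - ContinuousLinearMap.id ℝ E, ?_⟩
  refine (hWd.sub (hasFDerivWithinAt_id x D)).congr (fun y _ => ?_) ?_ <;> simp [hW]

end Differentiability

/-! ### The cube and subsets of full measure -/

theorem isOpen_cube (d : ℕ) : IsOpen (cube d) := by
  have : cube d = ⋂ i, {x : Space d | 0 < x i} ∩ {x | x i < 1} := by ext; simp [cube]
  rw [this]
  exact isOpen_iInter_of_finite fun i =>
    (isOpen_lt (by fun_prop) (by fun_prop)).inter (isOpen_lt (by fun_prop) (by fun_prop))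

theorem convex_cube (d : ℕ) : Convex ℝ (cube d) := by
  have : cube d = ⋂ i, (EuclideanSpace.proj i : Space d →L[ℝ] ℝ) ⁻¹' (Ioo 0 1) := by
    ext; simp [cube]
  rw [this]
  exact convex_iInter fun i => (convex_Ioo 0 1).linear_preimage _

theorem cube_subset_closedCube (d : ℕ) : cube d ⊆ closedCube d :=
  fun _ hx i => ⟨(hx i).1.le, (hx i).2.le⟩

theorem isBounded_closedCube (d : ℕ) : Bornology.IsBounded (closedCube d) := by
  refine (Metric.isBounded_closedBall (x := (0 : Space d)) (r := √d)).subset fun x hx => ?_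
  rw [mem_closedBall_zero_iff, EuclideanSpace.norm_eq]
  refine Real.sqrt_le_sqrt ?_
  calc ∑ i, ‖x i‖ ^ 2 ≤ ∑ _i : Fin d, (1 : ℝ) := Finset.sum_le_sum fun i _ => by
        rw [Real.norm_of_nonneg (hx i).1]; exact pow_le_one₀ (hx i).1 (hx i).2
    _ = d := by simp

theorem isBounded_cube (d : ℕ) : Bornology.IsBounded (cube d) :=
  (isBounded_closedCube d).subset (cube_subset_closedCube d)

theorem measurableSet_cube (d : ℕ) : MeasurableSet (cube d) := (isOpen_cube d).measurableSet

theorem volume_cube_lt_top (d : ℕ) : volume (cube d) < ⊤ := (isBounded_cube d).measure_lt_top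

/-- Derivatives within a set need a definite set, so almost everywhere statements are turned into
pointwise ones on a measurable subset of full measure. -/
theorem exists_measurable_subset_cube {d : ℕ} {p : Space d → Prop}
    (hp : ∀ᵐ x ∂volume.restrict (cube d), p x) :
    ∃ D ⊆ cube d, MeasurableSet D ∧ volume (cube d \ D) = 0 ∧ ∀ x ∈ D, p x := by
  rw [ae_restrict_iff' (measurableSet_cube d), ae_iff] at hp
  set N := toMeasurable volume {x | ¬(x ∈ cube d → p x)} with hN
  refine ⟨cube d \ N, sdiff_subset, (measurableSet_cube d).diff (measurableSet_toMeasurable _ _),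
    measure_mono_null (t := N) ?_ (by rw [hN, measure_toMeasurable, hp]), fun x hx => ?_⟩
  · intro x hx
    by_contra hcon
    exact hx.2 ⟨hx.1, hcon⟩
  · by_contra hcon
    exact hx.2 (subset_toMeasurable _ _ fun h => hcon (h hx.1))

/-! ### Second derivatives of the potentials on a set of full measure -/

/-- On the set `D` of full measure, `t` is a gradient of a convex function which is
differentiable within `D`, with derivative `A`. -/
structure IsTwiceDiffOn (d : ℕ) (t : Space d → Space d) (D : Set (Space d))
    (A : Space d → Space d →L[ℝ] Space d) : Prop where
  measurableSet : MeasurableSet D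
  subset : D ⊆ cube d
  volume_diff : volume (cube d \ D) = 0
  measurable : Measurable A
  hasFDerivWithinAt : ∀ x ∈ D, HasFDerivWithinAt t (A x) D x
  mapsTo : MapsTo t D (cube d)
  subgrad : ∃ φ, IsSubgradOn φ t D

theorem gradPotentials_exists_isTwiceDiffOn {d : ℕ} {t : Space d → Space d}
    (ht : t ∈ gradPotentials d) : ∃ D A, IsTwiceDiffOn d t D A := by
  obtain ⟨φ, ⟨hconv, hφ⟩, htφ⟩ := ht
  obtain ⟨D₀, hD₀, -, hD₀vol, hD₀p⟩ := exists_measurable_subset_cube (hφ.and htφ)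
  have hgrad : ∀ x ∈ D₀, HasFDerivAt φ (innerSL ℝ (t x)) x := fun x hx => by
    rw [(hD₀p x hx).2]
    exact (hD₀p x hx).1.1.hasGradientAt.hasFDerivAt
  have hsub : ∀ x ∈ D₀, ∀ y ∈ cube d, φ x + ⟪t x, y - x⟫ ≤ φ y := fun x hx y hy =>
    hconv.add_fderiv_le (cube_subset_closedCube d (hD₀ hx)) (cube_subset_closedCube d hy)
      (hgrad x hx)
  obtain ⟨N, hN, hNA⟩ :=
    exists_hasFDerivWithinAt_of_subgrad volume (isOpen_cube d) hsub hD₀ hgrad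
  have hae : ∀ᵐ x ∂volume.restrict (cube d), x ∈ D₀ \ N := by
    rw [ae_restrict_iff' (measurableSet_cube d), ae_iff]
    refine measure_mono_null (t := (cube d \ D₀) ∪ N) ?_ (measure_union_null hD₀vol hN)
    intro x hx
    by_contra hcon
    exact hx fun h => ⟨by_contra fun h' => hcon (Or.inl ⟨h, h'⟩), fun h' => hcon (Or.inr h')⟩
  obtain ⟨D₁, hD₁, hD₁meas, hD₁vol, hD₁p⟩ := exists_measurable_subset_cube hae
  choose! A₀ hA₀ using hNA
  have hA₁ : ∀ x ∈ D₁, HasFDerivWithinAt t (A₀ x) D₁ x := fun x hx =>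
    (hA₀ x (hD₁p x hx)).mono fun y hy => (hD₁p y hy).1
  -- The derivatives were picked by choice; they are replaced by a measurable version at the cost of
  -- one more null set.
  have hmeas := aemeasurable_fderivWithin volume hD₁meas hA₁
  have hae₂ : ∀ᵐ x ∂volume.restrict (cube d), x ∈ D₁ ∧ A₀ x = hmeas.mk A₀ x := by
    have e1 := (ae_restrict_iff' hD₁meas).1 hmeas.ae_eq_mk
    have e2 : ∀ᵐ x, x ∉ cube d \ D₁ := measure_eq_zero_iff_ae_notMem.1 hD₁vol
    rw [ae_restrict_iff' (measurableSet_cube d)]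
    filter_upwards [e1, e2] with x h1 h2 hx
    have : x ∈ D₁ := by by_contra hcon; exact h2 ⟨hx, hcon⟩
    exact ⟨this, h1 this⟩
  obtain ⟨D₂, hD₂, hD₂meas, hD₂vol, hD₂p⟩ := exists_measurable_subset_cube hae₂
  refine ⟨D₂, hmeas.mk A₀, hD₂meas, hD₂, hD₂vol, hmeas.measurable_mk, fun x hx => ?_, fun x hx => ?_,
    φ, fun x hx y hy => ?_⟩
  · rw [← (hD₂p x hx).2]
    exact (hA₁ x (hD₂p x hx).1).mono fun y hy => (hD₂p y hy).1
  · have := hD₀p x (hD₁p x (hD₂p x hx).1).1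
    rw [this.2]; exact this.1.2
  · exact hsub x (hD₁p x (hD₂p x hx).1).1 y (hD₂ hy)

namespace IsTwiceDiffOn

variable {d : ℕ} {t : Space d → Space d} {D : Set (Space d)} {A : Space d → Space d →L[ℝ] Space d}

/-- A subset of full measure is dense in the cube, as nonempty open sets have positive volume. -/
theorem closure_mem_nhds (h : IsTwiceDiffOn d t D A) {x : Space d} (hx : x ∈ D) :
    closure D ∈ 𝓝 x := by
  refine mem_of_superset ((isOpen_cube d).mem_nhds (h.subset hx)) fun y hy => ?_
  by_contra hcon
  have hopen : IsOpen (cube d \ closure D) := (isOpen_cube d).sdiff isClosed_closure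
  exact (hopen.measure_pos volume ⟨y, hy, hcon⟩).ne'
    (measure_mono_null (sdiff_subset_sdiff_right subset_closure) h.volume_diff)

theorem mono (h : IsTwiceDiffOn d t D A) {D' : Set (Space d)} (hD' : MeasurableSet D')
    (hsub : D' ⊆ D) (hvol : volume (cube d \ D') = 0) : IsTwiceDiffOn d t D' A where
  measurableSet := hD'
  subset := hsub.trans h.subset
  volume_diff := hvol
  measurable := h.measurable
  hasFDerivWithinAt x hx := (h.hasFDerivWithinAt x (hsub hx)).mono hsub
  mapsTo := h.mapsTo.mono_left hsub
  subgrad := h.subgrad.imp fun _ hφ => hφ.mono hsub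

theorem isPositive (h : IsTwiceDiffOn d t D A) {x : Space d} (hx : x ∈ D) :
    (A x : Space d →ₗ[ℝ] Space d).IsPositive := by
  obtain ⟨φ, hφ⟩ := h.subgrad
  exact hφ.isPositive hx (h.closure_mem_nhds hx) (h.hasFDerivWithinAt x hx)

theorem injOn (h : IsTwiceDiffOn d t D A) : InjOn t {x ∈ D | (A x).det ≠ 0} := by
  obtain ⟨φ, hφ⟩ := h.subgrad
  exact fun x hx y hy hxy => hφ.eq_of_apply_eq (h.closure_mem_nhds hx.1) hy.1
    (h.hasFDerivWithinAt x hx.1) hx.2 hxy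

theorem convexCombination {t' : Space d → Space d} {A' : Space d → Space d →L[ℝ] Space d}
    (h : IsTwiceDiffOn d t D A) (h' : IsTwiceDiffOn d t' D A') {a b : ℝ} (ha : 0 ≤ a) (hb : 0 ≤ b)
    (hab : a + b = 1) :
    IsTwiceDiffOn d (a • t + b • t') D (fun x => a • A x + b • A' x) where
  measurableSet := h.measurableSet
  subset := h.subset
  volume_diff := h.volume_diff
  measurable := (h.measurable.const_smul a).add (h'.measurable.const_smul b)
  hasFDerivWithinAt x hx :=
    ((h.hasFDerivWithinAt x hx).const_smul a).add ((h'.hasFDerivWithinAt x hx).const_smul b)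
  mapsTo x hx := convex_cube d (h.mapsTo hx) (h'.mapsTo hx) ha hb hab
  subgrad := by
    obtain ⟨φ, hφ⟩ := h.subgrad
    obtain ⟨φ', hφ'⟩ := h'.subgrad
    exact ⟨_, hφ.convexCombination hφ' ha hb⟩

theorem restrict_eq (h : IsTwiceDiffOn d t D A) :
    volume.restrict (cube d) = (volume.restrict D : Measure (Space d)) :=
  Measure.restrict_congr_set (by
    refine ae_eq_set.2 ⟨h.volume_diff, ?_⟩
    rw [sdiff_eq_empty.2 h.subset, measure_empty])

theorem aemeasurable (h : IsTwiceDiffOn d t D A) : AEMeasurable t (volume.restrict (cube d)) := by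
  rw [h.restrict_eq]
  have : ContinuousOn t D := fun x hx => (h.hasFDerivWithinAt x hx).continuousWithinAt
  exact this.aemeasurable h.measurableSet

end IsTwiceDiffOn

theorem exists_common_isTwiceDiffOn {d : ℕ} {t₀ t₁ : Space d → Space d}
    (h₀ : t₀ ∈ gradPotentials d) (h₁ : t₁ ∈ gradPotentials d) :
    ∃ D A₀ A₁, IsTwiceDiffOn d t₀ D A₀ ∧ IsTwiceDiffOn d t₁ D A₁ := by
  obtain ⟨D₀, A₀, H₀⟩ := gradPotentials_exists_isTwiceDiffOn h₀
  obtain ⟨D₁, A₁, H₁⟩ := gradPotentials_exists_isTwiceDiffOn h₁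
  have hvol : volume (cube d \ (D₀ ∩ D₁)) = 0 := by
    rw [sdiff_inter]; exact measure_union_null H₀.volume_diff H₁.volume_diff
  have hm := H₀.measurableSet.inter H₁.measurableSet
  exact ⟨D₀ ∩ D₁, A₀, A₁, H₀.mono hm inter_subset_left hvol, H₁.mono hm inter_subset_right hvol⟩

theorem convex_gradPotentials (d : ℕ) : Convex ℝ (gradPotentials d) := by
  rintro t₀ ⟨φ₀, ⟨hc₀, hd₀⟩, h₀⟩ t₁ ⟨φ₁, ⟨hc₁, hd₁⟩, h₁⟩ a b ha hb hab
  have key : ∀ x, DifferentiableAt ℝ φ₀ x → DifferentiableAt ℝ φ₁ x →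
      HasGradientAt (a • φ₀ + b • φ₁) (a • gradient φ₀ x + b • gradient φ₁ x) x := by
    intro x h h'
    have := (h.hasGradientAt.hasFDerivAt.const_smul a).add (h'.hasGradientAt.hasFDerivAt.const_smul b)
    rw [hasGradientAt_iff_hasFDerivAt]
    refine this.congr_fderiv ?_
    ext; simp
  refine ⟨a • φ₀ + b • φ₁, ⟨(hc₀.smul ha).add (hc₁.smul hb), ?_⟩, ?_⟩
  · filter_upwards [hd₀, hd₁] with x h h'
    refine ⟨(key x h.1 h'.1).differentiableAt, ?_⟩
    rw [(key x h.1 h'.1).gradient]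
    exact convex_cube d h.2 h'.2 ha hb hab
  · filter_upwards [hd₀, hd₁, h₀, h₁] with x h h' e e'
    rw [(key x h.1 h'.1).gradient, Pi.add_apply, Pi.smul_apply, Pi.smul_apply, e, e']

/-! ### Minkowski's determinant inequality -/

section Minkowski

/-- Superadditivity of the geometric mean. -/
theorem _root_.Real.one_add_prod_rpow_le {ι : Type*} (s : Finset ι) (hs : s.Nonempty) (e : ι → ℝ)
    (he : ∀ i ∈ s, 0 ≤ e i) :
    1 + (∏ i ∈ s, e i) ^ ((s.card : ℝ)⁻¹) ≤ (∏ i ∈ s, (1 + e i)) ^ ((s.card : ℝ)⁻¹) := by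
  have hc : (0 : ℝ) < s.card := by exact_mod_cast hs.card_pos
  have hw : ∑ _i ∈ s, (s.card : ℝ)⁻¹ = 1 := by simp [hc.ne']
  have hp : ∀ i ∈ s, 0 < 1 + e i := fun i hi => by linarith [he i hi]
  -- AM-GM is applied to `1 / (1 + e i)` and to `e i / (1 + e i)`, whose arithmetic means add up to
  -- `1`.
  have h1 := Real.geom_mean_le_arith_mean_weighted s (fun _ => (s.card : ℝ)⁻¹)
    (fun i => 1 / (1 + e i)) (fun _ _ => by positivity) hw
    (fun i hi => (one_div_pos.2 (hp i hi)).le)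
  have h2 := Real.geom_mean_le_arith_mean_weighted s (fun _ => (s.card : ℝ)⁻¹)
    (fun i => e i / (1 + e i)) (fun _ _ => by positivity) hw
    (fun i hi => div_nonneg (he i hi) (hp i hi).le)
  have hsum : ∑ i ∈ s, (s.card : ℝ)⁻¹ * (1 / (1 + e i))
      + ∑ i ∈ s, (s.card : ℝ)⁻¹ * (e i / (1 + e i)) = 1 := by
    rw [← Finset.sum_add_distrib]
    refine Eq.trans ?_ hw
    refine Finset.sum_congr rfl fun i hi => ?_
    have := (hp i hi).ne'
    field_simp
  rw [Real.finsetProd_rpow _ _ (fun i hi => (one_div_pos.2 (hp i hi)).le), Finset.prod_div_distrib,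
    Finset.prod_const_one] at h1
  rw [Real.finsetProd_rpow _ _ (fun i hi => div_nonneg (he i hi) (hp i hi).le),
    Finset.prod_div_distrib] at h2
  have hP : 0 < ∏ i ∈ s, (1 + e i) := Finset.prod_pos hp
  rw [Real.div_rpow zero_le_one hP.le, Real.one_rpow] at h1
  rw [Real.div_rpow (Finset.prod_nonneg he) hP.le] at h2
  have hPr : 0 < (∏ i ∈ s, (1 + e i)) ^ ((s.card : ℝ)⁻¹) := Real.rpow_pos_of_pos hP _
  have h3 := (add_le_add h1 h2).trans hsum.le
  rwa [← add_div, div_le_one hPr] at h3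

open Matrix MatrixOrder in
/-- Minkowski's determinant inequality, the first summand being invertible. -/
theorem _root_.Matrix.PosSemidef.rpow_det_add_le_aux {n : Type*} [Fintype n] [DecidableEq n]
    [Nonempty n] {A B : Matrix n n ℝ} (hA : A.PosSemidef) (hB : B.PosSemidef) (hdet : A.det ≠ 0) :
    A.det ^ ((Fintype.card n : ℝ)⁻¹) + B.det ^ ((Fintype.card n : ℝ)⁻¹)
      ≤ (A + B).det ^ ((Fintype.card n : ℝ)⁻¹) := by
  obtain ⟨C, hC⟩ := CStarAlgebra.nonneg_iff_eq_star_mul_self.1 hA.nonneg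
  rw [star_eq_conjTranspose] at hC
  have hCdet : IsUnit C.det := by
    rw [hC, det_mul] at hdet
    exact isUnit_iff_ne_zero.2 (right_ne_zero_of_mul hdet)
  have hCHdet : IsUnit Cᴴ.det := by
    rw [det_conjTranspose]; exact hCdet.star
  -- Congruence by `C` reduces the pair `A`, `B` to `1`, `F`, where the inequality concerns only the
  -- eigenvalues of `F`.
  set F := (C⁻¹)ᴴ * B * C⁻¹ with hF
  have hFpos : F.PosSemidef := hB.conjTranspose_mul_mul_same _
  have hBF : B = Cᴴ * F * C := by
    rw [hF, conjTranspose_nonsing_inv, mul_assoc, mul_assoc (Cᴴ⁻¹ * B), nonsing_inv_mul _ hCdet,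
      mul_one, ← mul_assoc, mul_nonsing_inv _ hCHdet, one_mul]
  have hAB : A + B = Cᴴ * (1 + F) * C := by
    rw [mul_add, add_mul, mul_one, ← hBF, ← hC]
  have d1 : B.det = A.det * F.det := by
    conv_lhs => rw [hBF]
    rw [hC]; simp only [det_mul]; ring
  have d2 : (A + B).det = A.det * (1 + F).det := by
    rw [hAB, hC]; simp only [det_mul]; ring
  have d3 : F.det = ∏ i, hFpos.isHermitian.eigenvalues i := by
    simpa using hFpos.isHermitian.det_eq_prod_eigenvalues
  have d4 : (1 + F).det = ∏ i, (1 + hFpos.isHermitian.eigenvalues i) := by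
    -- The characteristic polynomial at `-1` is `det (1 + F)` up to sign.
    have := congrArg (Polynomial.eval (-1)) hFpos.isHermitian.charpoly_eq
    rw [Matrix.eval_charpoly, Polynomial.eval_prod] at this
    simp only [Polynomial.eval_sub, Polynomial.eval_X, Polynomial.eval_C] at this
    have e1 : scalar n (-1 : ℝ) - F = -(1 + F) := by
      rw [map_neg, map_one]; abel
    have e2 : ∀ i, (-1 : ℝ) - (hFpos.isHermitian.eigenvalues i : ℝ)
        = -(1 + hFpos.isHermitian.eigenvalues i) := fun i => by ring
    rw [e1, det_neg] at this
    simp only [RCLike.ofReal_real_eq_id, id, e2, Finset.prod_neg, Finset.card_univ] at this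
    exact mul_left_cancel₀ (pow_ne_zero _ (by norm_num)) this
  have hA0 := hA.det_nonneg
  have hF0 := hFpos.det_nonneg
  have key := Real.one_add_prod_rpow_le Finset.univ Finset.univ_nonempty
    hFpos.isHermitian.eigenvalues fun i _ => hFpos.eigenvalues_nonneg i
  rw [← d3, ← d4, Finset.card_univ] at key
  have h1 : 0 ≤ (1 + F).det := (PosSemidef.one.add hFpos).det_nonneg
  rw [d1, d2, Real.mul_rpow hA0 hF0, Real.mul_rpow hA0 h1]
  have := mul_le_mul_of_nonneg_left key (Real.rpow_nonneg hA0 ((Fintype.card n : ℝ)⁻¹))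
  linarith

open Matrix in
/-- Minkowski's determinant inequality. -/
theorem _root_.Matrix.PosSemidef.rpow_det_add_le {n : Type*} [Fintype n] [DecidableEq n]
    [Nonempty n] {A B : Matrix n n ℝ} (hA : A.PosSemidef) (hB : B.PosSemidef) :
    A.det ^ ((Fintype.card n : ℝ)⁻¹) + B.det ^ ((Fintype.card n : ℝ)⁻¹)
      ≤ (A + B).det ^ ((Fintype.card n : ℝ)⁻¹) := by
  by_cases h : A.det = 0
  · by_cases h' : B.det = 0
    · have : ((Fintype.card n : ℝ)⁻¹) ≠ 0 := by simp
      rw [h, h', Real.zero_rpow this, add_zero]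
      exact Real.rpow_nonneg (hA.add hB).det_nonneg _
    · rw [add_comm, add_comm A]
      exact hB.rpow_det_add_le_aux hA h'
  · exact hA.rpow_det_add_le_aux hB h

variable {d : ℕ} {A B : Space d →L[ℝ] Space d}

theorem posSemidef_toMatrix (hA : (A : Space d →ₗ[ℝ] Space d).IsPositive) :
    (LinearMap.toMatrix (EuclideanSpace.basisFun (Fin d) ℝ).toBasis
      (EuclideanSpace.basisFun (Fin d) ℝ).toBasis (A : Space d →ₗ[ℝ] Space d)).PosSemidef :=
  (LinearMap.posSemidef_toMatrix_iff _).2 hA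

theorem det_eq_det_toMatrix (A : Space d →L[ℝ] Space d) :
    A.det = (LinearMap.toMatrix (EuclideanSpace.basisFun (Fin d) ℝ).toBasis
      (EuclideanSpace.basisFun (Fin d) ℝ).toBasis (A : Space d →ₗ[ℝ] Space d)).det :=
  (LinearMap.det_toMatrix _ _).symm

theorem det_nonneg_of_isPositive (hA : (A : Space d →ₗ[ℝ] Space d).IsPositive) : 0 ≤ A.det := by
  rw [det_eq_det_toMatrix]
  exact (posSemidef_toMatrix hA).det_nonneg

/-- Minkowski's inequality for `a • A` and `b • B`: the root of order `d` turns the factor `a ^ d`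
of the determinant into `a`. -/
theorem concave_rpow_det (hd : 1 ≤ d) (hA : (A : Space d →ₗ[ℝ] Space d).IsPositive)
    (hB : (B : Space d →ₗ[ℝ] Space d).IsPositive) {a b : ℝ} (ha : 0 ≤ a) (hb : 0 ≤ b) :
    a * A.det ^ ((d : ℝ)⁻¹) + b * B.det ^ ((d : ℝ)⁻¹) ≤ (a • A + b • B).det ^ ((d : ℝ)⁻¹) := by
  have : Nonempty (Fin d) := ⟨⟨0, hd⟩⟩
  have hd0 : d ≠ 0 := by omega
  have h := ((posSemidef_toMatrix hA).smul ha).rpow_det_add_le ((posSemidef_toMatrix hB).smul hb)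
  rw [Matrix.det_smul, Matrix.det_smul, ← det_eq_det_toMatrix, ← det_eq_det_toMatrix,
    Fintype.card_fin, Real.mul_rpow (pow_nonneg ha _) (det_nonneg_of_isPositive hA),
    Real.mul_rpow (pow_nonneg hb _) (det_nonneg_of_isPositive hB), Real.pow_rpow_inv_natCast ha hd0,
    Real.pow_rpow_inv_natCast hb hd0] at h
  rw [det_eq_det_toMatrix (a • A + b • B)]
  simpa using h

end Minkowski

/-! ### The internal energy density and `h_*` -/

section EnergyDensity

variable {P h : ℝ → ℝ}

theorem IsEnergyDensity.convexOn (hh : IsEnergyDensity P h) (hP : IsPressure P) :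
    ConvexOn ℝ (Ici 0) h := by
  refine convexOn_of_deriv2_nonneg (convex_Ici 0) hh.continuousOn ?_ ?_ ?_
  · rw [interior_Ici]
    exact hh.contDiffOn.differentiableOn (by norm_num)
  · rw [interior_Ici]
    exact ((contDiffOn_succ_iff_deriv_of_isOpen (n := 1) isOpen_Ioi).1
      (by simpa using! hh.contDiffOn)).2.2.differentiableOn (by norm_num)
  · rw [interior_Ici]
    intro r hr
    have h1 := hh.deriv_eq r hr
    have h2 : 0 ≤ deriv P r := by
      have : derivWithin P (Ici 0) r = deriv P r := derivWithin_of_mem_nhds (Ici_mem_nhds hr)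
      rw [← this]
      exact hP.strictMonoOn.monotoneOn.derivWithin_nonneg
    rw [h1] at h2
    exact nonneg_of_mul_nonneg_right h2 hr

/-- With `r = 1 / s` this is the monotonicity of the slope `h r / r` of a convex function vanishing
at `0`. -/
theorem hStar_antitoneOn (hconv : ConvexOn ℝ (Ici 0) h) (h0 : h 0 = 0) :
    AntitoneOn (hStar h) (Ioi 0) := by
  intro a ha b hb hab
  rw [mem_Ioi] at ha hb
  have hθ : a / b ≤ 1 := (div_le_one hb).2 hab
  have key := hconv.2 (show 1 / a ∈ Ici 0 from (one_div_pos.2 ha).le) (mem_Ici.2 le_rfl)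
    (show 0 ≤ a / b by positivity) (show 0 ≤ 1 - a / b by linarith) (by ring)
  simp only [smul_eq_mul, mul_zero, add_zero, h0] at key
  have e : a / b * (1 / a) = 1 / b := by field_simp
  rw [e] at key
  simp only [hStar]
  calc b * h (1 / b) ≤ b * (a / b * h (1 / a)) := mul_le_mul_of_nonneg_left key hb.le
    _ = a * h (1 / a) := by field_simp

theorem hStar_le_hStarZero (hconv : ConvexOn ℝ (Ici 0) h) (h0 : h 0 = 0) {s : ℝ} (hs : 0 < s) :
    ((hStar h s : ℝ) : EReal) ≤ hStarZero h := by
  refine le_limsup_of_frequently_le (Eventually.frequently ?_)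
  have : Ioo 0 s ∈ 𝓝[>] (0 : ℝ) := Ioo_mem_nhdsGT hs
  filter_upwards [this] with r hr
  exact EReal.coe_le_coe_iff.2 (hStar_antitoneOn hconv h0 hr.1 hs hr.2.le)

theorem hStarZero_ne_bot (hconv : ConvexOn ℝ (Ici 0) h) (h0 : h 0 = 0) : hStarZero h ≠ ⊥ :=
  ne_bot_of_le_ne_bot (EReal.coe_ne_bot _) (hStar_le_hStarZero hconv h0 one_pos)

/-- `h_*` on `[0,∞)`, with the value at `0` replaced by zero if it is infinite. -/
def hStarExt (h : ℝ → ℝ) (s : ℝ) : ℝ := if s = 0 then (hStarZero h).toReal else hStar h s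

theorem hStarExt_antitoneOn (hconv : ConvexOn ℝ (Ici 0) h) (h0 : h 0 = 0) :
    AntitoneOn (hStarExt h) (Ioi 0) := by
  intro a ha b hb hab
  rw [hStarExt, hStarExt, if_neg (ne_of_gt (mem_Ioi.1 ha)), if_neg (ne_of_gt (mem_Ioi.1 hb))]
  exact hStar_antitoneOn hconv h0 ha hb hab

theorem hStarExt_antitoneOn_Ici (hconv : ConvexOn ℝ (Ici 0) h) (h0 : h 0 = 0)
    (htop : hStarZero h ≠ ⊤) : AntitoneOn (hStarExt h) (Ici 0) := by
  intro a ha b hb hab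
  rcases eq_or_lt_of_le (show 0 ≤ a from ha) with rfl | ha'
  · rcases eq_or_lt_of_le (show 0 ≤ b from hb) with rfl | hb'
    · exact le_rfl
    · rw [hStarExt, hStarExt, if_pos rfl, if_neg hb'.ne']
      rw [← EReal.coe_le_coe_iff, EReal.coe_toReal htop (hStarZero_ne_bot hconv h0)]
      exact hStar_le_hStarZero hconv h0 hb'
  · exact hStarExt_antitoneOn hconv h0 ha' (ha'.trans_le hab) hab

theorem hStarExt_convexOn_Ioi {d : ℕ} (hMC : McCannCondition d h) :
    ConvexOn ℝ (Ioi 0) fun z : ℝ => hStarExt h (z ^ d) := by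
  refine ConvexOn.congr hMC fun z hz => ?_
  simp only [hStarExt]
  rw [if_neg (pow_pos hz d).ne']

/-- Continuity at `0` is not needed: monotonicity controls the shifted end values, and a limit is
taken only at the combined point, once it is positive. -/
theorem hStarExt_convexOn_Ici {d : ℕ} (hd : 1 ≤ d) (hMC : McCannCondition d h)
    (hconv : ConvexOn ℝ (Ici 0) h) (h0 : h 0 = 0) (htop : hStarZero h ≠ ⊤) :
    ConvexOn ℝ (Ici 0) fun z : ℝ => hStarExt h (z ^ d) := by
  set H := fun z : ℝ => hStarExt h (z ^ d) with hH
  have hd0 : d ≠ 0 := by omega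
  have hI : ConvexOn ℝ (Ioi 0) H := hStarExt_convexOn_Ioi hMC
  have hanti : AntitoneOn H (Ici 0) := fun a ha b hb hab =>
    hStarExt_antitoneOn_Ici hconv h0 htop (mem_Ici.2 (pow_nonneg ha d)) (mem_Ici.2 (pow_nonneg hb d))
      (pow_le_pow_left₀ ha hab d)
  have hcont : ContinuousOn H (Ioi 0) := hI.continuousOn isOpen_Ioi
  -- shift the arguments into the open half line and let the shift tend to zero
  refine ⟨convex_Ici 0, fun x hx y hy a b ha hb hab => ?_⟩
  rw [mem_Ici] at hx hy
  simp only [smul_eq_mul]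
  have hz : 0 ≤ a * x + b * y := by positivity
  rcases eq_or_lt_of_le hz with hz0 | hzpos
  · have hx' : a * H x = a * H 0 := by
      have : a * x = 0 := by nlinarith [mul_nonneg ha hx, mul_nonneg hb hy]
      rcases mul_eq_zero.1 this with h | h <;> simp [h]
    have hy' : b * H y = b * H 0 := by
      have : b * y = 0 := by nlinarith [mul_nonneg ha hx, mul_nonneg hb hy]
      rcases mul_eq_zero.1 this with h | h <;> simp [h]
    rw [← hz0, hx', hy', ← add_mul, hab, one_mul]
  · have hlim : Tendsto (fun ε : ℝ => H (a * (x + ε) + b * (y + ε))) (𝓝[>] 0)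
        (𝓝 (H (a * x + b * y))) := by
      have h1 : Tendsto (fun ε : ℝ => a * (x + ε) + b * (y + ε)) (𝓝 0) (𝓝 (a * x + b * y)) := by
        have : Continuous fun ε : ℝ => a * (x + ε) + b * (y + ε) := by fun_prop
        simpa using this.tendsto 0
      exact ((hcont.continuousAt (Ioi_mem_nhds hzpos)).tendsto.comp h1).mono_left
        nhdsWithin_le_nhds
    refine le_of_tendsto hlim ?_
    filter_upwards [self_mem_nhdsWithin] with ε hε
    rw [mem_Ioi] at hε
    have h1 := hI.2 (x := x + ε) (y := y + ε) (by rw [mem_Ioi]; linarith) (by rw [mem_Ioi]; linarith)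
      ha hb hab
    simp only [smul_eq_mul] at h1
    refine h1.trans (add_le_add (mul_le_mul_of_nonneg_left ?_ ha) (mul_le_mul_of_nonneg_left ?_ hb))
    · exact hanti hx (by rw [mem_Ici]; linarith) (by linarith)
    · exact hanti hy (by rw [mem_Ici]; linarith) (by linarith)

/-- The energy density along a concave determinant root is convex. -/
theorem hStarExt_le_of_rpow_concave {d : ℕ} (hd : 1 ≤ d) (hMC : McCannCondition d h)
    (hconv : ConvexOn ℝ (Ici 0) h) (h0 : h 0 = 0) {m m₀ m₁ a b : ℝ} (hm : 0 ≤ m) (hm₀ : 0 ≤ m₀)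
    (hm₁ : 0 ≤ m₁) (ha : 0 < a) (hb : 0 < b) (hab : a + b = 1)
    (hconc : a * m₀ ^ ((d : ℝ)⁻¹) + b * m₁ ^ ((d : ℝ)⁻¹) ≤ m ^ ((d : ℝ)⁻¹))
    (hpos : hStarZero h = ⊤ → 0 < m₀ ∧ 0 < m₁) :
    hStarExt h m ≤ a * hStarExt h m₀ + b * hStarExt h m₁ := by
  have hd0 : d ≠ 0 := by omega
  set z₀ := m₀ ^ ((d : ℝ)⁻¹) with hz₀
  set z₁ := m₁ ^ ((d : ℝ)⁻¹) with hz₁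
  have e₀ : z₀ ^ d = m₀ := Real.rpow_inv_natCast_pow hm₀ hd0
  have e₁ : z₁ ^ d = m₁ := Real.rpow_inv_natCast_pow hm₁ hd0
  have e : (m ^ ((d : ℝ)⁻¹)) ^ d = m := Real.rpow_inv_natCast_pow hm hd0
  have n₀ : 0 ≤ z₀ := Real.rpow_nonneg hm₀ _
  have n₁ : 0 ≤ z₁ := Real.rpow_nonneg hm₁ _
  have hn : 0 ≤ a * z₀ + b * z₁ := by positivity
  have hpow : (a * z₀ + b * z₁) ^ d ≤ m := by
    rw [← e]; exact pow_le_pow_left₀ hn hconc d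
  -- If `h_*(0) = ∞`, then `hStarExt h 0` is the default value `0` and convexity fails at the
  -- origin; `hpos` keeps both arguments away from it.
  by_cases htop : hStarZero h = ⊤
  · obtain ⟨p₀, p₁⟩ := hpos htop
    have q₀ : 0 < z₀ := Real.rpow_pos_of_pos p₀ _
    have q₁ : 0 < z₁ := Real.rpow_pos_of_pos p₁ _
    have h1 := (hStarExt_convexOn_Ioi hMC).2 q₀ q₁ ha.le hb.le hab
    simp only [smul_eq_mul, e₀, e₁] at h1
    have hp : 0 < (a * z₀ + b * z₁) ^ d := by positivity
    exact (hStarExt_antitoneOn hconv h0 hp (hp.trans_le hpow) hpow).trans h1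
  · have h1 := (hStarExt_convexOn_Ici hd hMC hconv h0 htop).2 n₀ n₁ ha.le hb.le hab
    simp only [smul_eq_mul, e₀, e₁] at h1
    exact (hStarExt_antitoneOn_Ici hconv h0 htop (pow_nonneg hn d) hm hpow).trans h1

/-- Bounds the negative part of the internal energy by volume plus mass, which keeps the entropy
above `-∞`. -/
theorem exists_affine_le (hconv : ConvexOn ℝ (Ici 0) h) (h0 : h 0 = 0) :
    ∃ C, 0 ≤ C ∧ ∀ r, 0 ≤ r → -(C * (1 + r)) ≤ h r := by
  -- for `r ≥ 1` compare with the slope at `1`, for `r ≤ 1` with the slope at `2`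
  refine ⟨|h 1| + |h 2| + 2 * |h 1|, by positivity, fun r hr => ?_⟩
  have a1 := neg_abs_le (h 1); have a2 := le_abs_self (h 1); have a3 := le_abs_self (h 2)
  have b1 := abs_nonneg (h 1); have b2 := abs_nonneg (h 2)
  rcases le_total 1 r with h1 | h1
  · have key := hconv.2 (mem_Ici.2 hr) (mem_Ici.2 le_rfl) (show 0 ≤ 1 / r by positivity)
      (show 0 ≤ 1 - 1 / r by rw [sub_nonneg, div_le_one (by linarith)]; exact h1) (by ring)
    have hr0 : r ≠ 0 := by linarith
    simp only [smul_eq_mul, mul_zero, add_zero, h0, one_div, inv_mul_cancel₀ hr0] at key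
    have : r * h 1 ≤ h r := by
      have := mul_le_mul_of_nonneg_left key hr
      rwa [← mul_assoc, mul_inv_cancel₀ hr0, one_mul] at this
    nlinarith
  · have key := hconv.2 (mem_Ici.2 hr) (show (2 : ℝ) ∈ Ici 0 by simp)
      (show 0 ≤ 1 / (2 - r) by rw [one_div]; exact inv_nonneg.2 (by linarith))
      (show 0 ≤ 1 - 1 / (2 - r) by rw [sub_nonneg, div_le_one (by linarith)]; linarith) (by ring)
    have hr0 : 2 - r ≠ 0 := by linarith
    have e : 1 / (2 - r) * r + (1 - 1 / (2 - r)) * 2 = 1 := by field_simp; ring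
    simp only [smul_eq_mul, e] at key
    have k2 := mul_le_mul_of_nonneg_left key (show 0 ≤ 2 - r by linarith)
    have e2 : (2 - r) * (1 / (2 - r) * h r + (1 - 1 / (2 - r)) * h 2) = h r + (1 - r) * h 2 := by
      field_simp; ring
    rw [e2] at k2
    nlinarith

end EnergyDensity

/-! ### The potential energy density -/

section Potential

variable {d : ℕ} {lam : ℝ} {V : Space d → ℝ}

theorem IsPotential.convexOn (hV : IsPotential d lam V) :
    ConvexOn ℝ (cube d) fun x => V x - lam / 2 * ‖x‖ ^ 2 := by
  refine ⟨convex_cube d, fun x hx y hy a b ha hb hab => ?_⟩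
  set γ : ℝ → Space d := fun r => x + r • (y - x) with hγ
  have hγc : ∀ r ∈ Icc (0 : ℝ) 1, γ r ∈ cube d := fun r hr => by
    have := convex_cube d hx hy (sub_nonneg.2 hr.2) hr.1 (by ring)
    have e : γ r = (1 - r) • x + r • y := by simp only [hγ]; module
    rwa [e]
  set v := y - x with hv
  have hγd : ∀ r, HasDerivAt γ v r := fun r => by
    simpa [hγ] using ((hasDerivAt_id r).smul_const v).const_add x
  have hcd : ∀ z ∈ cube d, ContDiffAt ℝ ∞ V z := fun z hz =>
    hV.contDiffOn.contDiffAt ((isOpen_cube d).mem_nhds hz)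
  set g : ℝ → ℝ := fun r => V (γ r) - lam / 2 * ‖γ r‖ ^ 2 with hg
  set g' : ℝ → ℝ := fun r => fderiv ℝ V (γ r) v - lam * inner ℝ (γ r) v with hg'
  set g'' : ℝ → ℝ := fun r => fderiv ℝ (fderiv ℝ V) (γ r) v v - lam * ‖v‖ ^ 2 with hg''
  have h1 : ∀ r ∈ Icc (0 : ℝ) 1, HasDerivAt g (g' r) r := fun r hr => by
    have e1 := ((hcd _ (hγc r hr)).differentiableAt (by simp)).hasFDerivAt.comp_hasDerivAt r (hγd r)
    have e2 := ((hγd r).norm_sq.const_mul (lam / 2))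
    refine (e1.sub e2).congr_deriv ?_
    simp only [hg']; ring
  have h2 : ∀ r ∈ Icc (0 : ℝ) 1, HasDerivAt g' (g'' r) r := fun r hr => by
    have e0 : DifferentiableAt ℝ (fderiv ℝ V) (γ r) :=
      (((hcd _ (hγc r hr)).of_le (m := 2) (WithTop.coe_le_coe.2 le_top)).fderiv_right (m := 1)
        one_add_one_eq_two.le).differentiableAt (by simp)
    have e1 := (e0.hasFDerivAt.comp_hasDerivAt r (hγd r)).clm_apply (hasDerivAt_const r v)
    have e2 := (((hγd r).inner ℝ (hasDerivAt_const r v)).const_mul lam)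
    refine (e1.sub e2).congr_deriv ?_
    simp [hg'']
  have hconv : ConvexOn ℝ (Icc 0 1) g := by
    refine convexOn_of_hasDerivWithinAt2_nonneg (convex_Icc 0 1)
      (fun r hr => (h1 r hr).continuousAt.continuousWithinAt) (f' := g') (f'' := g'') ?_ ?_ ?_
    · exact fun r hr => (h1 r (interior_subset hr)).hasDerivWithinAt
    · exact fun r hr => (h2 r (interior_subset hr)).hasDerivWithinAt
    · intro r hr
      have := hV.hessian_ge _ (hγc r (interior_subset hr)) v
      rw [iteratedFDeriv_two_apply] at this
      simp only [Matrix.cons_val_zero, Matrix.cons_val_one] at this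
      simp only [hg'']; linarith
  have := hconv.2 (left_mem_Icc.2 zero_le_one) (right_mem_Icc.2 zero_le_one) ha hb hab
  have eγ : γ b = a • x + b • y := by
    simp only [hγ, hv]
    rw [eq_sub_iff_add_eq.2 hab]; module
  have e0 : γ 0 = x := by simp [hγ]
  have e1 : γ 1 = y := by simp [hγ, hv]
  simp only [smul_eq_mul, mul_zero, mul_one, zero_add, hg, eγ, e0, e1] at this
  exact this

/-- The defect comes from the identity `‖a • x + b • y‖ ^ 2 = a * ‖x‖ ^ 2 + b * ‖y‖ ^ 2 - a * b * ‖y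
- x‖ ^ 2`. -/
theorem IsPotential.le_combination (hV : IsPotential d lam V) {x y : Space d} (hx : x ∈ cube d)
    (hy : y ∈ cube d) {a b : ℝ} (ha : 0 ≤ a) (hb : 0 ≤ b) (hab : a + b = 1) :
    V (a • x + b • y) ≤ a * V x + b * V y - lam / 2 * (a * b * ‖y - x‖ ^ 2) := by
  have := hV.convexOn.2 hx hy ha hb hab
  simp only [smul_eq_mul] at this
  have e : ‖a • x + b • y‖ ^ 2 = a * ‖x‖ ^ 2 + b * ‖y‖ ^ 2 - a * b * ‖y - x‖ ^ 2 := by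
    rw [norm_add_sq_real, norm_sub_sq_real, norm_smul, norm_smul, real_inner_smul_left,
      real_inner_smul_right, Real.norm_of_nonneg ha, Real.norm_of_nonneg hb, real_inner_comm x y]
    obtain rfl : a = 1 - b := by linarith
    ring
  rw [e] at this
  nlinarith

/-- `V` may blow up at the boundary, but only upwards: the tangent plane of the convex function `V -
lam / 2 * ‖·‖ ^ 2` at the centre bounds it from below. -/
theorem IsPotential.exists_le (hV : IsPotential d lam V) : ∃ C, ∀ x ∈ cube d, -C ≤ V x := by
  obtain ⟨R, hR⟩ := (isBounded_cube d).exists_norm_le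
  set c : Space d := WithLp.toLp 2 (fun _ => 1 / 2) with hc
  have hcc : c ∈ cube d := fun i => by simp [hc]; norm_num
  have hdiff : DifferentiableAt ℝ (fun x => V x - lam / 2 * ‖x‖ ^ 2) c := by
    have h1 : DifferentiableAt ℝ V c := (hV.contDiffOn.contDiffAt
      ((isOpen_cube d).mem_nhds hcc)).differentiableAt (by simp)
    exact h1.sub ((differentiableAt_id.norm_sq ℝ).const_mul _)
  set L := fderiv ℝ (fun x => V x - lam / 2 * ‖x‖ ^ 2) c with hL
  refine ⟨|V c - lam / 2 * ‖c‖ ^ 2| + ‖L‖ * (R + R) + |lam / 2| * R ^ 2, fun x hx => ?_⟩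
  have h1 := hV.convexOn.add_fderiv_le hcc hx hdiff.hasFDerivAt
  have h2 : -(‖L‖ * (R + R)) ≤ L (x - c) := by
    have e1 : ‖L (x - c)‖ ≤ ‖L‖ * (R + R) := (L.le_opNorm _).trans (by
      gcongr
      exact (norm_sub_le _ _).trans (add_le_add (hR x hx) (hR c hcc)))
    exact (abs_le.1 e1).1
  have h3 : -(|lam / 2| * R ^ 2) ≤ lam / 2 * ‖x‖ ^ 2 := by
    have e1 : |lam / 2 * ‖x‖ ^ 2| ≤ |lam / 2| * R ^ 2 := by
      rw [abs_mul, abs_of_nonneg (sq_nonneg ‖x‖)]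
      gcongr
      exact hR x hx
    exact (abs_le.1 e1).1
  have h4 := neg_abs_le (V c - lam / 2 * ‖c‖ ^ 2)
  linarith

theorem IsPotential.aemeasurable (hV : IsPotential d lam V) {ν : Measure (Space d)}
    (hν : ∀ᵐ x ∂ν, x ∈ cube d) : AEMeasurable V ν := by
  rw [← Measure.restrict_eq_self_of_ae_mem hν]
  exact hV.contDiffOn.continuousOn.aemeasurable (measurableSet_cube d)

end Potential

theorem _root_.EReal.coe_mul_ne_bot_of_pos {a : ℝ} (ha : 0 < a) {x : EReal} (hx : x ≠ ⊥) :
    (a : EReal) * x ≠ ⊥ := by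
  induction x with
  | bot => exact absurd rfl hx
  | coe x => rw [← EReal.coe_mul]; exact EReal.coe_ne_bot _
  | top => rw [EReal.coe_mul_top_of_pos ha]; exact top_ne_bot

/-! ### Extended integrals with finite negative part -/

section ExtIntegral

variable {α : Type*} [MeasurableSpace α] {μ : Measure α} {f : α → ℝ}

theorem extIntegral_ne_bot (hf : ∫⁻ x, ENNReal.ofReal (-f x) ∂μ ≠ ⊤) : extIntegral μ f ≠ ⊥ := by
  rw [extIntegral, ← EReal.coe_ennreal_toReal hf, Ne, sub_eq_add_neg, EReal.add_eq_bot_iff]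
  simp [-EReal.coe_neg]

theorem extIntegral_eq_integral (hf : Integrable f μ) : extIntegral μ f = ((∫ x, f x ∂μ : ℝ)) := by
  have h1 : ∫⁻ x, ENNReal.ofReal (f x) ∂μ ≠ ⊤ :=
    ((lintegral_mono fun x => Real.ofReal_le_enorm (f x)).trans_lt hf.2).ne
  have h2 : ∫⁻ x, ENNReal.ofReal (-f x) ∂μ ≠ ⊤ :=
    ((lintegral_mono fun x => Real.ofReal_le_enorm (-f x)).trans_lt hf.neg.2).ne
  rw [extIntegral, integral_eq_lintegral_pos_part_sub_lintegral_neg_part hf, EReal.coe_sub,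
    EReal.coe_ennreal_toReal h1, EReal.coe_ennreal_toReal h2]

theorem integrable_of_extIntegral_ne_top (hm : AEStronglyMeasurable f μ)
    (hf : ∫⁻ x, ENNReal.ofReal (-f x) ∂μ ≠ ⊤) (htop : extIntegral μ f ≠ ⊤) : Integrable f μ := by
  have hpos : ∫⁻ x, ENNReal.ofReal (f x) ∂μ ≠ ⊤ := by
    intro hcon
    refine htop ?_
    rw [extIntegral, hcon, ← EReal.coe_ennreal_toReal hf, EReal.coe_ennreal_top, EReal.top_sub_coe]
  refine ⟨hm, ?_⟩
  have : ∀ x, ‖f x‖ₑ ≤ ENNReal.ofReal (f x) + ENNReal.ofReal (-f x) := fun x => by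
    rcases le_total 0 (f x) with h | h
    · rw [Real.enorm_of_nonneg h]; exact le_self_add
    · rw [← enorm_neg, Real.enorm_of_nonneg (neg_nonneg.2 h)]; exact le_add_self
  refine (lintegral_mono this).trans_lt ?_
  rw [lintegral_add_left' hm.aemeasurable.ennreal_ofReal]
  exact ENNReal.add_lt_top.2 ⟨hpos.lt_top, hf.lt_top⟩

theorem integrable_of_le_integrable {g : α → ℝ} (hm : AEStronglyMeasurable f μ)
    (hf : ∫⁻ x, ENNReal.ofReal (-f x) ∂μ ≠ ⊤) (hg : Integrable g μ) (hle : ∀ᵐ x ∂μ, f x ≤ g x) :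
    Integrable f μ := by
  refine integrable_of_extIntegral_ne_top hm hf fun htop => ?_
  have hpos : ∫⁻ x, ENNReal.ofReal (f x) ∂μ < ⊤ := by
    refine (lintegral_mono_ae (hle.mono fun x hx => ?_)).trans_lt hg.2
    exact (ENNReal.ofReal_le_ofReal hx).trans (Real.ofReal_le_enorm (g x))
  rw [extIntegral, ← EReal.coe_ennreal_toReal hf, ← EReal.coe_ennreal_toReal hpos.ne,
    ← EReal.coe_sub] at htop
  exact EReal.coe_ne_top _ htop

end ExtIntegral

/-! ### Regular and degenerate points, densities -/

/-- The points of `D` where the derivative is invertible. -/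
def regularSet {d : ℕ} (D : Set (Space d)) (A : Space d → Space d →L[ℝ] Space d) :
    Set (Space d) := {x ∈ D | 0 < (A x).det}

/-- The points of `D` where the derivative is degenerate. -/
def degenerateSet {d : ℕ} (D : Set (Space d)) (A : Space d → Space d →L[ℝ] Space d) :
    Set (Space d) := {x ∈ D | (A x).det = 0}

/-- The density of the internal energy in Lagrangian coordinates. -/
def lagrangianDensity {d : ℕ} (h : ℝ → ℝ) (A : Space d → Space d →L[ℝ] Space d)
    (f : Space d → ℝ) (x : Space d) : ℝ := f x * hStarExt h ((A x).det / f x)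

/-- `μ` is the finite measure with density `f` on the cube. -/
structure HasDensity (d : ℕ) (μ : Measure (Space d)) (f : Space d → ℝ) : Prop where
  isFiniteMeasure : IsFiniteMeasure μ
  measurable : Measurable f
  nonneg : ∀ x, 0 ≤ f x
  eq_withDensity : μ = (volume.restrict (cube d)).withDensity fun x => ENNReal.ofReal (f x)

theorem exists_hasDensity {d : ℕ} {μ : Measure (Space d)} [IsFiniteMeasure μ]
    (hμ : μ ≪ volume.restrict (cube d)) : ∃ f, HasDensity d μ f := by
  refine ⟨fun x => (μ.rnDeriv (volume.restrict (cube d)) x).toReal, inferInstance,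
    (Measure.measurable_rnDeriv _ _).ennreal_toReal, fun x => ENNReal.toReal_nonneg, ?_⟩
  conv_lhs => rw [← Measure.withDensity_rnDeriv_eq _ _ hμ]
  refine withDensity_congr_ae ?_
  filter_upwards [Measure.rnDeriv_lt_top μ (volume.restrict (cube d))] with x hx
  rw [ENNReal.ofReal_toReal hx.ne]

namespace HasDensity

variable {d : ℕ} {μ : Measure (Space d)} {f : Space d → ℝ}

theorem absolutelyContinuous (hf : HasDensity d μ f) : μ ≪ volume.restrict (cube d) := by
  rw [hf.eq_withDensity]; exact withDensity_absolutelyContinuous _ _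

theorem apply (hf : HasDensity d μ f) {B : Set (Space d)} (hB : MeasurableSet B)
    (hBc : B ⊆ cube d) : μ B = ∫⁻ x in B, ENNReal.ofReal (f x) := by
  conv_lhs => rw [hf.eq_withDensity]
  rw [withDensity_apply _ hB, Measure.restrict_restrict hB, inter_eq_left.2 hBc]

theorem integrableOn (hf : HasDensity d μ f) : IntegrableOn f (cube d) := by
  have := hf.isFiniteMeasure
  refine ⟨hf.measurable.aestronglyMeasurable, ?_⟩
  rw [hasFiniteIntegral_iff_ofReal (Eventually.of_forall hf.nonneg),
    ← hf.apply (measurableSet_cube d) subset_rfl]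
  exact measure_lt_top _ _

end HasDensity

theorem measurable_det {d : ℕ} {A : Space d → Space d →L[ℝ] Space d} (hA : Measurable A) :
    Measurable fun x => (A x).det := ContinuousLinearMap.continuous_det.measurable.comp hA

/-! ### Push-forward under a convex gradient -/

namespace IsTwiceDiffOn

variable {d : ℕ} {t : Space d → Space d} {D : Set (Space d)} {A : Space d → Space d →L[ℝ] Space d}
  {μ : Measure (Space d)} {f : Space d → ℝ}

theorem measurableSet_regularSet (H : IsTwiceDiffOn d t D A) : MeasurableSet (regularSet D A) :=
  H.measurableSet.inter (measurableSet_lt measurable_const (measurable_det H.measurable))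

theorem measurableSet_degenerateSet (H : IsTwiceDiffOn d t D A) :
    MeasurableSet (degenerateSet D A) :=
  H.measurableSet.inter (measurableSet_eq_fun (measurable_det H.measurable) measurable_const)

theorem det_nonneg (H : IsTwiceDiffOn d t D A) {x : Space d} (hx : x ∈ D) : 0 ≤ (A x).det :=
  det_nonneg_of_isPositive (H.isPositive hx)

theorem union_eq (H : IsTwiceDiffOn d t D A) : regularSet D A ∪ degenerateSet D A = D := by
  ext x
  refine ⟨fun h => h.elim And.left And.left, fun hx => ?_⟩
  rcases (H.det_nonneg hx).lt_or_eq with h | h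
  · exact Or.inl ⟨hx, h⟩
  · exact Or.inr ⟨hx, h.symm⟩

theorem disjoint (D : Set (Space d)) (A : Space d → Space d →L[ℝ] Space d) :
    Disjoint (regularSet D A) (degenerateSet D A) :=
  Set.disjoint_left.2 fun _ h h' => h.2.ne' h'.2

theorem injOn_regularSet (H : IsTwiceDiffOn d t D A) : InjOn t (regularSet D A) := by
  refine H.injOn.mono ?_
  exact fun _ hx => ⟨hx.1, hx.2.ne'⟩

theorem exists_measurable_eqOn (H : IsTwiceDiffOn d t D A) :
    ∃ t', Measurable t' ∧ EqOn t' t D := by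
  classical
  have hc : ContinuousOn t D := fun x hx => (H.hasFDerivWithinAt x hx).continuousWithinAt
  refine ⟨D.piecewise t (fun _ => (0 : Space d)), hc.measurable_piecewise continuousOn_const H.measurableSet,
    fun x hx => piecewise_eq_of_mem _ _ _ hx⟩

theorem hasFDerivWithinAt_subset (H : IsTwiceDiffOn d t D A) {S : Set (Space d)} (hS : S ⊆ D) :
    ∀ x ∈ S, HasFDerivWithinAt t (A x) S x :=
  fun x hx => (H.hasFDerivWithinAt x (hS hx)).mono hS

theorem measurableSet_image (H : IsTwiceDiffOn d t D A) {S : Set (Space d)}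
    (hS : MeasurableSet S) (hSG : S ⊆ regularSet D A) : MeasurableSet (t '' S) :=
  measurable_image_of_fderivWithin hS (H.hasFDerivWithinAt_subset fun _ hx => (hSG hx).1)
    (H.injOn_regularSet.mono hSG)

theorem lintegral_image (H : IsTwiceDiffOn d t D A) {S : Set (Space d)}
    (hS : MeasurableSet S) (hSG : S ⊆ regularSet D A) (g : Space d → ℝ≥0∞) :
    ∫⁻ y in t '' S, g y = ∫⁻ x in S, ENNReal.ofReal (A x).det * g (t x) := by
  rw [lintegral_image_eq_lintegral_abs_det_fderiv_mul volume hS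
    (H.hasFDerivWithinAt_subset fun _ hx => (hSG hx).1) (H.injOn_regularSet.mono hSG)]
  refine setLIntegral_congr_fun hS fun x hx => ?_
  simp only [abs_of_pos (hSG hx).2]

theorem ae_mem (H : IsTwiceDiffOn d t D A) (hμ : μ ≪ volume.restrict (cube d)) :
    ∀ᵐ x ∂μ, x ∈ D := by
  refine hμ.ae_le ?_
  rw [H.restrict_eq]
  exact ae_restrict_mem H.measurableSet

theorem aemeasurable_of_ac (H : IsTwiceDiffOn d t D A) (hμ : μ ≪ volume.restrict (cube d)) :
    AEMeasurable t μ := H.aemeasurable.mono_ac hμ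

theorem map_eq_add (H : IsTwiceDiffOn d t D A) (hμ : μ ≪ volume.restrict (cube d)) :
    μ.map t = (μ.restrict (degenerateSet D A)).map t + (μ.restrict (regularSet D A)).map t := by
  have hm := H.aemeasurable_of_ac hμ
  ext B hB
  rw [Measure.add_apply, Measure.map_apply_of_aemeasurable hm hB,
    Measure.map_apply_of_aemeasurable hm.restrict hB,
    Measure.map_apply_of_aemeasurable hm.restrict hB, ← Measure.add_apply,
    add_comm, ← Measure.restrict_union (disjoint D A) H.measurableSet_degenerateSet, H.union_eq,
    Measure.restrict_eq_self_of_ae_mem (H.ae_mem hμ)]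

theorem map_restrict_apply (H : IsTwiceDiffOn d t D A) (hμ : μ ≪ volume.restrict (cube d))
    {S B : Set (Space d)} (hS : MeasurableSet S) (hB : MeasurableSet B) :
    (μ.restrict S).map t B = μ (t ⁻¹' B ∩ S) := by
  rw [Measure.map_apply_of_aemeasurable (H.aemeasurable_of_ac hμ).restrict hB,
    Measure.restrict_apply' hS]

/-- By Sard, the set of values at points with vanishing determinant is Lebesgue-null, and it carries
all of this measure. -/
theorem map_degenerate_mutuallySingular (H : IsTwiceDiffOn d t D A)
    (hμ : μ ≪ volume.restrict (cube d)) :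
    (μ.restrict (degenerateSet D A)).map t ⟂ₘ volume := by
  have h0 : volume (t '' degenerateSet D A) = 0 :=
    addHaar_image_eq_zero_of_det_fderivWithin_eq_zero volume
      (H.hasFDerivWithinAt_subset fun _ hx => hx.1) fun x hx => hx.2
  refine ⟨(toMeasurable volume (t '' degenerateSet D A))ᶜ, (measurableSet_toMeasurable _ _).compl,
    ?_, by rw [compl_compl, measure_toMeasurable, h0]⟩
  rw [H.map_restrict_apply hμ H.measurableSet_degenerateSet (measurableSet_toMeasurable _ _).compl]
  convert measure_empty (μ := μ)
  refine eq_empty_of_forall_notMem fun x hx => hx.1 ?_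
  exact subset_toMeasurable _ _ (mem_image_of_mem t hx.2)

/-- If `B` is null, the determinant integrates to `0` over its preimage by the area formula; being
positive there, it forces the preimage to be null. -/
theorem map_regular_absolutelyContinuous (H : IsTwiceDiffOn d t D A)
    (hμ : μ ≪ volume.restrict (cube d)) :
    (μ.restrict (regularSet D A)).map t ≪ volume := by
  refine Measure.AbsolutelyContinuous.mk fun B hB hB0 => ?_
  rw [H.map_restrict_apply hμ H.measurableSet_regularSet hB]
  obtain ⟨t', ht', heq⟩ := H.exists_measurable_eqOn
  set S := t' ⁻¹' B ∩ regularSet D A with hS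
  have hSm : MeasurableSet S := (ht' hB).inter H.measurableSet_regularSet
  have e : t ⁻¹' B ∩ regularSet D A = S := by
    ext x
    refine and_congr_left fun hx => ?_
    rw [mem_preimage, mem_preimage, heq hx.1]
  have hvol : volume (t '' S) = 0 := measure_mono_null (by
    rw [← e]; rintro _ ⟨x, hx, rfl⟩; exact hx.1) hB0
  have h1 := H.lintegral_image hSm inter_subset_right fun _ => 1
  rw [lintegral_one, Measure.restrict_apply_univ, hvol, eq_comm, lintegral_eq_zero_iff
    (by simpa using (measurable_det H.measurable).ennreal_ofReal)] at h1
  have h2 : volume S = 0 := by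
    have h3 := (ae_restrict_iff' hSm).1 h1
    refine measure_mono_null (fun x hx => ?_) (ae_iff.1 h3)
    simp [hx.2.2, hx]
  rw [e]
  exact hμ (Measure.absolutelyContinuous_of_le Measure.restrict_le_self h2)

section Density

variable [IsFiniteMeasure μ]

theorem map_eq_add_withDensity (H : IsTwiceDiffOn d t D A) (hμ : μ ≪ volume.restrict (cube d)) :
    μ.map t = (μ.restrict (degenerateSet D A)).map t
      + volume.withDensity (((μ.restrict (regularSet D A)).map t).rnDeriv volume) := by
  rw [Measure.withDensity_rnDeriv_eq _ _ (H.map_regular_absolutelyContinuous hμ)]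
  exact H.map_eq_add hμ

/-- Uniqueness of the Lebesgue decomposition: the degenerate points supply the singular part, the
regular ones the density. -/
theorem rnDeriv_map_ae_eq (H : IsTwiceDiffOn d t D A) (hμ : μ ≪ volume.restrict (cube d)) :
    ((μ.restrict (regularSet D A)).map t).rnDeriv volume =ᵐ[volume] (μ.map t).rnDeriv volume :=
  Measure.eq_rnDeriv (Measure.measurable_rnDeriv _ _) (H.map_degenerate_mutuallySingular hμ)
    (H.map_eq_add_withDensity hμ)

theorem singularPart_map (H : IsTwiceDiffOn d t D A) (hμ : μ ≪ volume.restrict (cube d)) :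
    (μ.map t).singularPart volume (cube d) = μ (degenerateSet D A) := by
  rw [← Measure.eq_singularPart (Measure.measurable_rnDeriv _ _)
    (H.map_degenerate_mutuallySingular hμ) (H.map_eq_add_withDensity hμ),
    H.map_restrict_apply hμ H.measurableSet_degenerateSet (measurableSet_cube d)]
  congr 1
  exact inter_eq_right.2 fun x hx => H.mapsTo hx.1

/-- The Monge–Ampère equation. Both sides have integral `μ S` over each measurable set `S` of
regular points, because injectivity makes `S` the full preimage of `t '' S` among them. -/
theorem det_mul_rnDeriv_ae_eq (H : IsTwiceDiffOn d t D A) (hf : HasDensity d μ f) :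
    ∀ᵐ x ∂volume.restrict (regularSet D A), ENNReal.ofReal (A x).det *
      ((μ.restrict (regularSet D A)).map t).rnDeriv volume (t x) = ENNReal.ofReal (f x) := by
  obtain ⟨t', ht', heq⟩ := H.exists_measurable_eqOn
  have hμ := hf.absolutelyContinuous
  set g := ((μ.restrict (regularSet D A)).map t).rnDeriv volume with hg
  have key : (fun x => ENNReal.ofReal (A x).det * g (t' x))
      =ᵐ[volume.restrict (regularSet D A)] fun x => ENNReal.ofReal (f x) := by
    refine ae_eq_of_forall_setLIntegral_eq_of_sigmaFinite
      ((measurable_det H.measurable).ennreal_ofReal.mul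
        ((Measure.measurable_rnDeriv _ _).comp ht')) hf.measurable.ennreal_ofReal
      fun s hs _ => ?_
    rw [Measure.restrict_restrict hs]
    set S := s ∩ regularSet D A with hS
    have hSm : MeasurableSet S := hs.inter H.measurableSet_regularSet
    have hSG : S ⊆ regularSet D A := inter_subset_right
    have hcongr : ∫⁻ x in S, ENNReal.ofReal (A x).det * g (t' x)
        = ∫⁻ x in S, ENNReal.ofReal (A x).det * g (t x) :=
      setLIntegral_congr_fun hSm fun x hx => by simp only [heq (hSG hx).1]
    rw [hcongr, ← H.lintegral_image hSm hSG, hg,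
      Measure.setLIntegral_rnDeriv (H.map_regular_absolutelyContinuous hμ),
      H.map_restrict_apply hμ H.measurableSet_regularSet (H.measurableSet_image hSm hSG),
      ← hf.apply hSm fun x hx => H.subset (hSG hx).1]
    congr 1
    ext x
    refine ⟨fun ⟨⟨y, hy, hyx⟩, hx⟩ => ?_, fun hx => ⟨mem_image_of_mem t hx, hSG hx⟩⟩
    rwa [← H.injOn_regularSet (hSG hy) hx hyx]
  filter_upwards [key, ae_restrict_mem H.measurableSet_regularSet] with x hx hxG
  rw [← hx, heq hxG.1]

theorem rnDeriv_ae_eq_zero (H : IsTwiceDiffOn d t D A) (hμ : μ ≪ volume.restrict (cube d)) :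
    ∀ᵐ y ∂volume.restrict (t '' regularSet D A)ᶜ,
      ((μ.restrict (regularSet D A)).map t).rnDeriv volume y = 0 := by
  have hm := H.measurableSet_image H.measurableSet_regularSet subset_rfl
  have h0 : ∫⁻ y in (t '' regularSet D A)ᶜ,
      ((μ.restrict (regularSet D A)).map t).rnDeriv volume y = 0 := by
    rw [Measure.setLIntegral_rnDeriv (H.map_regular_absolutelyContinuous hμ),
      H.map_restrict_apply hμ H.measurableSet_regularSet hm.compl]
    convert measure_empty (μ := μ)
    exact eq_empty_of_forall_notMem fun x hx => hx.1 (mem_image_of_mem t hx.2)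
  exact (lintegral_eq_zero_iff (Measure.measurable_rnDeriv _ _)).1 h0

/-- The change of variables formula for the absolutely continuous part of a push-forward. -/
theorem lintegral_comp_rnDeriv_map (H : IsTwiceDiffOn d t D A) (hf : HasDensity d μ f)
    {Φ : ℝ → ℝ≥0∞} (hΦ : Φ 0 = 0) :
    ∫⁻ y in cube d, Φ ((μ.map t).rnDeriv volume y).toReal
      = ∫⁻ x in regularSet D A, ENNReal.ofReal (A x).det * Φ (f x / (A x).det) := by
  have hμ := hf.absolutelyContinuous
  have hm := H.measurableSet_image H.measurableSet_regularSet subset_rfl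
  set g := ((μ.restrict (regularSet D A)).map t).rnDeriv volume with hg
  have e1 : ∫⁻ y in cube d, Φ ((μ.map t).rnDeriv volume y).toReal
      = ∫⁻ y in cube d, Φ (g y).toReal := by
    refine lintegral_congr_ae (ae_restrict_of_ae ?_)
    filter_upwards [H.rnDeriv_map_ae_eq hμ] with y hy
    rw [← hy]
  have hsub : t '' regularSet D A ⊆ cube d := by
    rintro _ ⟨x, hx, rfl⟩; exact H.mapsTo hx.1
  have e2 : ∫⁻ y in cube d \ t '' regularSet D A, Φ (g y).toReal = 0 := by
    have := ae_restrict_of_ae_restrict_of_subset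
      (fun y hy => hy.2 : cube d \ t '' regularSet D A ⊆ (t '' regularSet D A)ᶜ)
      (H.rnDeriv_ae_eq_zero hμ)
    rw [lintegral_congr_ae (g := fun _ => 0), lintegral_zero]
    filter_upwards [this] with y hy
    rw [hg, hy, ENNReal.toReal_zero, hΦ]
  rw [e1, ← lintegral_inter_add_sdiff _ (cube d) hm, inter_eq_right.2 hsub, e2, add_zero,
    H.lintegral_image H.measurableSet_regularSet subset_rfl]
  refine lintegral_congr_ae ?_
  filter_upwards [H.det_mul_rnDeriv_ae_eq hf, ae_restrict_mem H.measurableSet_regularSet]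
    with x hx hxG
  have h2 := congrArg ENNReal.toReal hx
  rw [ENNReal.toReal_mul, ENNReal.toReal_ofReal hxG.2.le, ENNReal.toReal_ofReal (hf.nonneg x)] at h2
  rw [← h2, mul_div_cancel_left₀ _ hxG.2.ne']

end Density

end IsTwiceDiffOn

/-! ### The entropy in Lagrangian coordinates -/

namespace IsTwiceDiffOn

variable {d : ℕ} {t : Space d → Space d} {D : Set (Space d)} {A : Space d → Space d →L[ℝ] Space d}
  {μ : Measure (Space d)} {f : Space d → ℝ} {h : ℝ → ℝ} {lam : ℝ} {V : Space d → ℝ}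

theorem det_mul_energy {f m : ℝ} (h0 : h 0 = 0) (hm : 0 < m) :
    m * h (f / m) = f * hStarExt h (m / f) := by
  rcases eq_or_ne f 0 with rfl | hf
  · simp [h0]
  · rw [hStarExt, if_neg (div_ne_zero hm.ne' hf), hStar, one_div_div]
    field_simp

theorem extIntegral_energy (H : IsTwiceDiffOn d t D A) (hf : HasDensity d μ f) (h0 : h 0 = 0) :
    extIntegral (volume.restrict (cube d)) (fun y => h ((μ.map t).rnDeriv volume y).toReal)
      = extIntegral (volume.restrict (regularSet D A)) (lagrangianDensity h A f) := by
  have := hf.isFiniteMeasure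
  have e1 := H.lintegral_comp_rnDeriv_map hf (Φ := fun r => ENNReal.ofReal (h r)) (by simp [h0])
  have e2 := H.lintegral_comp_rnDeriv_map hf (Φ := fun r => ENNReal.ofReal (-h r)) (by simp [h0])
  rw [extIntegral, extIntegral, e1, e2]
  congr 1
  · refine congrArg ENNReal.toEReal (setLIntegral_congr_fun H.measurableSet_regularSet fun x hx => ?_)
    simp only [lagrangianDensity]
    rw [← ENNReal.ofReal_mul hx.2.le, det_mul_energy h0 hx.2]
  · refine congrArg ENNReal.toEReal (setLIntegral_congr_fun H.measurableSet_regularSet fun x hx => ?_)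
    simp only [lagrangianDensity]
    rw [← ENNReal.ofReal_mul hx.2.le, mul_neg, det_mul_energy h0 hx.2]

/-- After the affine bound only two integrals remain: that of the determinant is the volume of the
image, contained in the cube, and that of `f` is at most the mass of `μ`. -/
theorem lintegral_neg_energy_ne_top (H : IsTwiceDiffOn d t D A) (hf : HasDensity d μ f)
    (hconv : ConvexOn ℝ (Ici 0) h) (h0 : h 0 = 0) :
    ∫⁻ x in regularSet D A, ENNReal.ofReal (-lagrangianDensity h A f x) ≠ ⊤ := by
  obtain ⟨C, hC, hCh⟩ := exists_affine_le hconv h0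
  have hle : ∀ x ∈ regularSet D A, ENNReal.ofReal (-lagrangianDensity h A f x)
      ≤ ENNReal.ofReal C * (ENNReal.ofReal (A x).det * 1 + ENNReal.ofReal (f x)) := by
    intro x hx
    have h1 := hCh (f x / (A x).det) (div_nonneg (hf.nonneg x) hx.2.le)
    have h2 := mul_le_mul_of_nonneg_left h1 hx.2.le
    rw [det_mul_energy h0 hx.2] at h2
    rw [mul_one, ← ENNReal.ofReal_add hx.2.le (hf.nonneg x), ← ENNReal.ofReal_mul hC]
    refine ENNReal.ofReal_le_ofReal ?_
    simp only [lagrangianDensity]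
    have e : (A x).det * -(C * (1 + f x / (A x).det)) = -(C * ((A x).det + f x)) := by
      have := hx.2.ne'
      field_simp
    linarith
  refine ne_top_of_le_ne_top ?_ (setLIntegral_mono' H.measurableSet_regularSet hle)
  rw [lintegral_const_mul' _ _ ENNReal.ofReal_ne_top,
    lintegral_add_right _ hf.measurable.ennreal_ofReal,
    ← H.lintegral_image H.measurableSet_regularSet subset_rfl (fun _ => 1),
    lintegral_one, Measure.restrict_apply_univ,
    ← hf.apply H.measurableSet_regularSet fun x hx => H.subset hx.1]
  have := hf.isFiniteMeasure
  have hsub : t '' regularSet D A ⊆ cube d := by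
    rintro _ ⟨x, hx, rfl⟩; exact H.mapsTo hx.1
  exact ENNReal.mul_ne_top ENNReal.ofReal_ne_top (ENNReal.add_ne_top.2
    ⟨((measure_mono hsub).trans_lt (volume_cube_lt_top d)).ne, measure_ne_top _ _⟩)

theorem aestronglyMeasurable_lagrangianDensity (H : IsTwiceDiffOn d t D A)
    (hf : HasDensity d μ f) (hcont : ContinuousOn h (Ici 0)) :
    AEStronglyMeasurable (lagrangianDensity h A f) (volume.restrict (cube d)) := by
  classical
  -- Nothing is known about `h` on negative numbers, so it is cut off there; only nonnegative
  -- arguments occur on `D`.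
  have hk : Measurable ((Ici 0).piecewise h 0) :=
    hcont.measurable_piecewise continuousOn_const measurableSet_Ici
  have hk' : Measurable fun s : ℝ =>
      if s = 0 then (hStarZero h).toReal else s * (Ici 0).piecewise h 0 (1 / s) :=
    Measurable.ite (measurableSet_singleton 0) measurable_const
      (measurable_id.mul (hk.comp (measurable_const.div measurable_id)))
  have hm := hf.measurable.mul (hk'.comp ((measurable_det H.measurable).div hf.measurable))
  refine hm.aestronglyMeasurable.congr ?_
  rw [H.restrict_eq]
  filter_upwards [ae_restrict_mem H.measurableSet] with x hx
  have hnn : 0 ≤ (A x).det / f x := div_nonneg (H.det_nonneg hx) (hf.nonneg x)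
  simp only [lagrangianDensity, Pi.mul_apply, Function.comp_apply, hStarExt, hStar, Pi.div_apply]
  rw [piecewise_eq_of_mem (Ici 0) h 0 (show 1 / ((A x).det / f x) ∈ Ici 0 from
    one_div_nonneg.2 hnn)]

/-- This is the true singular energy if `h_*(0)` is finite. If `h_*(0) = ∞`, the default value of
`toReal` makes it `0`, which is right only when the degenerate set has no mass. -/
theorem lagrangianDensity_degenerate {x : Space d} (hx : x ∈ degenerateSet D A) :
    lagrangianDensity h A f x = f x * (hStarZero h).toReal := by
  rw [lagrangianDensity, hx.2, zero_div, hStarExt, if_pos rfl]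

theorem integrableOn_degenerate (H : IsTwiceDiffOn d t D A) (hf : HasDensity d μ f) :
    IntegrableOn (lagrangianDensity h A f) (degenerateSet D A) := by
  have h1 : IntegrableOn (fun x => f x * (hStarZero h).toReal) (degenerateSet D A) :=
    (hf.integrableOn.mono_set fun x hx => H.subset hx.1).mul_const _
  exact h1.congr_fun (fun x hx => (lagrangianDensity_degenerate hx).symm)
    H.measurableSet_degenerateSet

theorem setIntegral_degenerate (H : IsTwiceDiffOn d t D A) (hf : HasDensity d μ f) :
    ∫ x in degenerateSet D A, lagrangianDensity h A f x
      = (hStarZero h).toReal * (μ (degenerateSet D A)).toReal := by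
  rw [setIntegral_congr_fun H.measurableSet_degenerateSet
    fun x hx => lagrangianDensity_degenerate hx, integral_mul_const, mul_comm,
    integral_eq_lintegral_of_nonneg_ae (Eventually.of_forall hf.nonneg)
      hf.measurable.aestronglyMeasurable,
    ← hf.apply H.measurableSet_degenerateSet fun x hx => H.subset hx.1]

theorem map_ae_mem_cube (H : IsTwiceDiffOn d t D A) (hμ : μ ≪ volume.restrict (cube d)) :
    ∀ᵐ y ∂μ.map t, y ∈ cube d := by
  refine (ae_map_iff (p := (· ∈ cube d)) (H.aemeasurable_of_ac hμ) (measurableSet_cube d)).2 ?_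
  exact (H.ae_mem hμ).mono fun x hx => H.mapsTo hx

theorem extIntegral_potential (H : IsTwiceDiffOn d t D A) (hμ : μ ≪ volume.restrict (cube d))
    (hV : IsPotential d lam V) :
    extIntegral ((μ.map t).restrict (cube d)) V = extIntegral μ (V ∘ t) := by
  have hc := H.map_ae_mem_cube hμ
  have hm := H.aemeasurable_of_ac hμ
  rw [Measure.restrict_eq_self_of_ae_mem hc, extIntegral, extIntegral,
    lintegral_map' (hV.aemeasurable hc).ennreal_ofReal hm,
    lintegral_map' (f := fun x => ENNReal.ofReal (-V x)) (hV.aemeasurable hc).neg.ennreal_ofReal hm]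
  rfl

theorem aestronglyMeasurable_potential (H : IsTwiceDiffOn d t D A)
    (hμ : μ ≪ volume.restrict (cube d)) (hV : IsPotential d lam V) :
    AEStronglyMeasurable (V ∘ t) μ :=
  ((hV.aemeasurable (H.map_ae_mem_cube hμ)).comp_aemeasurable
    (H.aemeasurable_of_ac hμ)).aestronglyMeasurable

theorem lintegral_neg_potential_ne_top [IsFiniteMeasure μ] (H : IsTwiceDiffOn d t D A)
    (hμ : μ ≪ volume.restrict (cube d)) (hV : IsPotential d lam V) :
    ∫⁻ x, ENNReal.ofReal (-(V ∘ t) x) ∂μ ≠ ⊤ := by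
  obtain ⟨C, hC⟩ := hV.exists_le
  refine ne_top_of_le_ne_top ?_ (lintegral_mono_ae (g := fun _ => ENNReal.ofReal C) ?_)
  · rw [lintegral_const]
    exact ENNReal.mul_ne_top ENNReal.ofReal_ne_top (measure_ne_top _ _)
  · filter_upwards [H.ae_mem hμ] with x hx
    refine ENNReal.ofReal_le_ofReal ?_
    have := hC _ (H.mapsTo hx)
    simp only [Function.comp_apply]; linarith

/-- The entropy of a push-forward in Lagrangian coordinates. -/
theorem entropy_map (H : IsTwiceDiffOn d t D A) (hf : HasDensity d μ f) (h0 : h 0 = 0)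
    (hV : IsPotential d lam V) :
    entropy d h V (μ.map t)
      = extIntegral (volume.restrict (regularSet D A)) (lagrangianDensity h A f)
        + hStarZero h * ((μ (degenerateSet D A) : ℝ≥0∞) : EReal) + extIntegral μ (V ∘ t) := by
  have := hf.isFiniteMeasure
  have hμ := hf.absolutelyContinuous
  rw [entropy, H.extIntegral_energy hf h0, H.singularPart_map hμ, H.extIntegral_potential hμ hV]

theorem singular_energy_ne_bot (hconv : ConvexOn ℝ (Ici 0) h) (h0 : h 0 = 0) [IsFiniteMeasure μ]
    (Z : Set (Space d)) : hStarZero h * ((μ Z : ℝ≥0∞) : EReal) ≠ ⊥ := by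
  rw [← EReal.coe_ennreal_toReal (measure_ne_top μ Z)]
  rcases eq_or_ne (hStarZero h) ⊤ with htop | htop
  · rw [htop]
    rcases (ENNReal.toReal_nonneg (a := μ Z)).eq_or_lt with h | h
    · simp [← h]
    · simp [EReal.top_mul_coe_of_pos h]
  · rw [← EReal.coe_toReal htop (hStarZero_ne_bot hconv h0), ← EReal.coe_mul]
    exact EReal.coe_ne_bot _

theorem entropy_map_ne_bot (H : IsTwiceDiffOn d t D A) (hf : HasDensity d μ f)
    (hconv : ConvexOn ℝ (Ici 0) h) (h0 : h 0 = 0) (hV : IsPotential d lam V) :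
    entropy d h V (μ.map t) ≠ ⊥ := by
  have := hf.isFiniteMeasure
  have hμ := hf.absolutelyContinuous
  rw [H.entropy_map hf h0 hV, Ne, EReal.add_eq_bot_iff, EReal.add_eq_bot_iff]
  push Not
  exact ⟨⟨extIntegral_ne_bot (H.lintegral_neg_energy_ne_top hf hconv h0),
    singular_energy_ne_bot hconv h0 _⟩,
    extIntegral_ne_bot (H.lintegral_neg_potential_ne_top hμ hV)⟩

theorem integrableOn_iff (H : IsTwiceDiffOn d t D A) (hf : HasDensity d μ f) :
    IntegrableOn (lagrangianDensity h A f) (cube d)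
      ↔ IntegrableOn (lagrangianDensity h A f) (regularSet D A) := by
  rw [IntegrableOn, H.restrict_eq, ← IntegrableOn]
  conv_lhs => rw [← H.union_eq]
  rw [integrableOn_union]
  exact and_iff_left (H.integrableOn_degenerate hf)

/-- None of the three summands is `-∞`, so a finite sum forces each of them to be finite; an
infinite `h_*(0)` then allows no singular mass. -/
theorem finite_of_entropy_map_ne_top (H : IsTwiceDiffOn d t D A) (hf : HasDensity d μ f)
    (hconv : ConvexOn ℝ (Ici 0) h) (hcont : ContinuousOn h (Ici 0)) (h0 : h 0 = 0)
    (hV : IsPotential d lam V) (hfin : entropy d h V (μ.map t) ≠ ⊤) :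
    IntegrableOn (lagrangianDensity h A f) (cube d) ∧ Integrable (V ∘ t) μ ∧
      (hStarZero h = ⊤ → μ (degenerateSet D A) = 0) := by
  have := hf.isFiniteMeasure
  have hμ := hf.absolutelyContinuous
  have b1 := extIntegral_ne_bot (H.lintegral_neg_energy_ne_top hf hconv h0)
  have b2 := singular_energy_ne_bot hconv h0 (μ := μ) (degenerateSet D A)
  have b3 := extIntegral_ne_bot (H.lintegral_neg_potential_ne_top hμ hV)
  rw [H.entropy_map hf h0 hV] at hfin
  have b12 : extIntegral (volume.restrict (regularSet D A)) (lagrangianDensity h A f)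
      + hStarZero h * ((μ (degenerateSet D A) : ℝ≥0∞) : EReal) ≠ ⊥ := by
    rw [Ne, EReal.add_eq_bot_iff, not_or]; exact ⟨b1, b2⟩
  have t3 : extIntegral μ (V ∘ t) ≠ ⊤ := fun hc => hfin (by rw [hc, EReal.add_top_of_ne_bot b12])
  have t12 : extIntegral (volume.restrict (regularSet D A)) (lagrangianDensity h A f)
      + hStarZero h * ((μ (degenerateSet D A) : ℝ≥0∞) : EReal) ≠ ⊤ :=
    fun hc => hfin (by rw [hc, EReal.top_add_of_ne_bot b3])
  have t1 : extIntegral (volume.restrict (regularSet D A)) (lagrangianDensity h A f) ≠ ⊤ :=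
    fun hc => t12 (by rw [hc, EReal.top_add_of_ne_bot b2])
  have t2 : hStarZero h * ((μ (degenerateSet D A) : ℝ≥0∞) : EReal) ≠ ⊤ :=
    fun hc => t12 (by rw [hc, EReal.add_top_of_ne_bot b1])
  refine ⟨?_, ?_, fun htop => ?_⟩
  · rw [H.integrableOn_iff hf]
    refine integrable_of_extIntegral_ne_top ?_ (H.lintegral_neg_energy_ne_top hf hconv h0) t1
    exact (H.aestronglyMeasurable_lagrangianDensity hf hcont).mono_measure
      (Measure.restrict_mono (fun x hx => H.subset hx.1) le_rfl)
  · exact integrable_of_extIntegral_ne_top (H.aestronglyMeasurable_potential hμ hV)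
      (H.lintegral_neg_potential_ne_top hμ hV) t3
  · by_contra hne
    refine t2 ?_
    rw [htop, ← EReal.coe_ennreal_toReal (measure_ne_top μ _)]
    exact EReal.top_mul_coe_of_pos (ENNReal.toReal_pos hne (measure_ne_top μ _))

theorem entropy_map_eq_integral (H : IsTwiceDiffOn d t D A) (hf : HasDensity d μ f)
    (hconv : ConvexOn ℝ (Ici 0) h) (h0 : h 0 = 0) (hV : IsPotential d lam V)
    (h1 : IntegrableOn (lagrangianDensity h A f) (cube d)) (h2 : Integrable (V ∘ t) μ)
    (h3 : hStarZero h = ⊤ → μ (degenerateSet D A) = 0) :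
    entropy d h V (μ.map t)
      = (((∫ x in cube d, lagrangianDensity h A f x) + ∫ x, V (t x) ∂μ : ℝ) : EReal) := by
  have := hf.isFiniteMeasure
  have h1' := (H.integrableOn_iff hf).1 h1
  have e2 : hStarZero h * ((μ (degenerateSet D A) : ℝ≥0∞) : EReal)
      = ((∫ x in degenerateSet D A, lagrangianDensity h A f x : ℝ) : EReal) := by
    rw [H.setIntegral_degenerate hf]
    rcases eq_or_ne (hStarZero h) ⊤ with htop | htop
    · rw [h3 htop]; simp
    · rw [EReal.coe_mul, EReal.coe_toReal htop (hStarZero_ne_bot hconv h0),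
        EReal.coe_ennreal_toReal (measure_ne_top μ _)]
  rw [H.entropy_map hf h0 hV, extIntegral_eq_integral h1', extIntegral_eq_integral h2, e2,
    ← EReal.coe_add, ← EReal.coe_add, H.restrict_eq,
    ← setIntegral_union (disjoint D A) H.measurableSet_degenerateSet h1'
      (H.integrableOn_degenerate hf), H.union_eq]
  rfl

theorem ae_eq_zero_or_det_pos (H : IsTwiceDiffOn d t D A) (hf : HasDensity d μ f)
    (h0 : μ (degenerateSet D A) = 0) :
    ∀ᵐ x ∂volume.restrict (cube d), f x = 0 ∨ 0 < (A x).det := by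
  rw [hf.apply H.measurableSet_degenerateSet fun x hx => H.subset hx.1,
    lintegral_eq_zero_iff hf.measurable.ennreal_ofReal,
    EventuallyEq, ae_restrict_iff' H.measurableSet_degenerateSet] at h0
  rw [H.restrict_eq, ae_restrict_iff' H.measurableSet]
  filter_upwards [h0] with x hx hxD
  rcases (H.det_nonneg hxD).lt_or_eq with h | h
  · exact Or.inr h
  · exact Or.inl (le_antisymm (ENNReal.ofReal_eq_zero.1 (hx ⟨hxD, h.symm⟩)) (hf.nonneg x))

theorem measure_degenerateSet_eq_zero (H : IsTwiceDiffOn d t D A) (hf : HasDensity d μ f)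
    (h0 : ∀ᵐ x ∂volume.restrict (cube d), f x = 0 ∨ 0 < (A x).det) :
    μ (degenerateSet D A) = 0 := by
  rw [hf.apply H.measurableSet_degenerateSet fun x hx => H.subset hx.1,
    lintegral_eq_zero_iff hf.measurable.ennreal_ofReal,
    EventuallyEq, ae_restrict_iff' H.measurableSet_degenerateSet]
  rw [ae_restrict_iff' (measurableSet_cube d)] at h0
  filter_upwards [h0] with x hx hxD
  rcases hx (H.subset hxD.1) with h | h
  · simp [h]
  · exact absurd hxD.2 h.ne'

end IsTwiceDiffOn

/-! ### The reference measure -/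

section PushForward

variable {d : ℕ} {M : ℝ} {u : Space d → ℝ} {T : Space d → Space d}

theorem volume_coordinate_eq (i : Fin d) (c : ℝ) : volume {x : Space d | x i = c} = 0 := by
  have h1 : volume {y : Fin d → ℝ | y i = c} = 0 := by
    rw [volume_pi]; exact Measure.pi_hyperplane (fun _ : Fin d => (volume : Measure ℝ)) i c
  have h2 := (PiLp.volume_preserving_ofLp (Fin d)).measure_preimage
    (s := {y : Fin d → ℝ | y i = c})
    (measurableSet_eq_fun (measurable_pi_apply i) measurable_const).nullMeasurableSet
  rw [h1] at h2
  exact h2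

theorem volume_closedCube_diff_cube (d : ℕ) : volume (closedCube d \ cube d) = 0 := by
  refine measure_mono_null (t := ⋃ i : Fin d, {x | x i = 0} ∪ {x | x i = 1}) ?_ ?_
  · rintro x ⟨hx, hx'⟩
    by_contra hcon
    simp only [mem_iUnion, mem_union, not_exists, not_or] at hcon
    exact hx' fun i => ⟨lt_of_le_of_ne (hx i).1 (Ne.symm (hcon i).1),
      lt_of_le_of_ne (hx i).2 (hcon i).2⟩
  · exact measure_iUnion_null fun i =>
      measure_union_null (volume_coordinate_eq i 0) (volume_coordinate_eq i 1)

theorem isFiniteMeasure_densityMeasure (hu : IsDensity d M u) :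
    IsFiniteMeasure (densityMeasure d u) :=
  isFiniteMeasure_withDensity_ofReal hu.integrableOn.2

theorem densityMeasure_absolutelyContinuous (d : ℕ) (u : Space d → ℝ) :
    densityMeasure d u ≪ volume.restrict (cube d) := withDensity_absolutelyContinuous _ _

theorem IsDiffPlus.aemeasurable (hT : IsDiffPlus d T) :
    AEMeasurable T (volume.restrict (cube d)) :=
  (hT.contDiffOn.continuousOn.mono (cube_subset_closedCube d)).aemeasurable (measurableSet_cube d)

/-- The preimage of a null set lies in its image under the `C¹` inverse. Points sent to the boundary
do no harm, since the faces of the cube are null. -/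
theorem pushForward_absolutelyContinuous (u : Space d → ℝ) (hT : IsDiffPlus d T) :
    pushForward d u T ≪ volume.restrict (cube d) := by
  obtain ⟨S, hST, hS⟩ := hT.contDiffOn_inv
  refine Measure.AbsolutelyContinuous.mk fun N hN hN0 => ?_
  rw [Measure.restrict_apply hN] at hN0
  rw [pushForward, Measure.map_apply_of_aemeasurable
    (hT.aemeasurable.mono_ac (densityMeasure_absolutelyContinuous d u)) hN]
  refine densityMeasure_absolutelyContinuous d u ?_
  rw [Measure.restrict_apply' (measurableSet_cube d)]
  have h1 : volume (N ∩ closedCube d) = 0 := by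
    refine measure_mono_null (t := (N ∩ cube d) ∪ (closedCube d \ cube d)) ?_
      (measure_union_null hN0 (volume_closedCube_diff_cube d))
    intro x hx
    by_cases hxc : x ∈ cube d
    · exact Or.inl ⟨hx.1, hxc⟩
    · exact Or.inr ⟨hx.2, hxc⟩
  have h2 := addHaar_image_eq_zero_of_differentiableOn_of_addHaar_eq_zero volume
    ((hS.differentiableOn (by simp)).mono inter_subset_right) h1
  refine measure_mono_null (fun x hx => ?_) h2
  have hx' := cube_subset_closedCube d hx.2
  exact ⟨T x, ⟨hx.1, hT.bijOn.mapsTo hx'⟩, hST.1 hx'⟩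

theorem isFiniteMeasure_pushForward (hu : IsDensity d M u) :
    IsFiniteMeasure (pushForward d u T) := by
  have := isFiniteMeasure_densityMeasure hu
  rw [pushForward]; infer_instance

theorem pushForward_comp (u : Space d → ℝ) (hT : IsDiffPlus d T) {t : Space d → Space d}
    (ht : AEMeasurable t (volume.restrict (cube d))) :
    pushForward d u (t ∘ T) = (pushForward d u T).map t :=
  (AEMeasurable.map_map_of_aemeasurable (ht.mono_ac (pushForward_absolutelyContinuous u hT))
    (hT.aemeasurable.mono_ac (densityMeasure_absolutelyContinuous d u))).symm

end PushForward

/-! ### Displacement convexity -/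

namespace IsTwiceDiffOn

variable {d : ℕ} {t t₀ t₁ : Space d → Space d} {D : Set (Space d)}
  {A A₀ A₁ : Space d → Space d →L[ℝ] Space d}
  {μ : Measure (Space d)} {f : Space d → ℝ} {h : ℝ → ℝ} {lam : ℝ} {V : Space d → ℝ}

theorem memLp [IsFiniteMeasure μ] (H : IsTwiceDiffOn d t D A)
    (hμ : μ ≪ volume.restrict (cube d)) : MemLp t 2 μ := by
  obtain ⟨R, hR⟩ := (isBounded_cube d).exists_norm_le
  exact MemLp.of_bound (H.aemeasurable_of_ac hμ).aestronglyMeasurable R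
    ((H.ae_mem hμ).mono fun x hx => hR _ (H.mapsTo hx))

/-- McCann's displacement convexity: the entropy is `lam`-convex along convex combinations of
gradients of convex functions. -/
theorem entropy_convexCombination_le (hd : 1 ≤ d) (H₀ : IsTwiceDiffOn d t₀ D A₀)
    (H₁ : IsTwiceDiffOn d t₁ D A₁) (hf : HasDensity d μ f) (hconv : ConvexOn ℝ (Ici 0) h)
    (hcont : ContinuousOn h (Ici 0)) (h0 : h 0 = 0) (hMC : McCannCondition d h)
    (hV : IsPotential d lam V) {a b : ℝ} (ha : 0 < a) (hb : 0 < b) (hab : a + b = 1)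
    (hfin₀ : entropy d h V (μ.map t₀) ≠ ⊤) (hfin₁ : entropy d h V (μ.map t₁) ≠ ⊤) :
    entropy d h V (μ.map (a • t₀ + b • t₁)) ≤
      (a : EReal) * entropy d h V (μ.map t₀) + (b : EReal) * entropy d h V (μ.map t₁)
        - ((lam / 2 * b * a * ∫ x, ‖t₁ x - t₀ x‖ ^ 2 ∂μ : ℝ) : EReal) := by
  have := hf.isFiniteMeasure
  have hμ := hf.absolutelyContinuous
  have H := H₀.convexCombination H₁ ha.le hb.le hab
  obtain ⟨i₀, v₀, z₀⟩ := H₀.finite_of_entropy_map_ne_top hf hconv hcont h0 hV hfin₀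
  obtain ⟨i₁, v₁, z₁⟩ := H₁.finite_of_entropy_map_ne_top hf hconv hcont h0 hV hfin₁
  set A : Space d → Space d →L[ℝ] Space d := fun x => a • A₀ x + b • A₁ x with hA
  have hdet : ∀ x ∈ D, a * (A₀ x).det ^ ((d : ℝ)⁻¹) + b * (A₁ x).det ^ ((d : ℝ)⁻¹)
      ≤ (A x).det ^ ((d : ℝ)⁻¹) := fun x hx =>
    concave_rpow_det hd (H₀.isPositive hx) (H₁.isPositive hx) ha.le hb.le
  have hpos : hStarZero h = ⊤ → ∀ᵐ x ∂volume.restrict (cube d),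
      f x = 0 ∨ 0 < (A₀ x).det ∧ 0 < (A₁ x).det := fun htop => by
    filter_upwards [H₀.ae_eq_zero_or_det_pos hf (z₀ htop),
      H₁.ae_eq_zero_or_det_pos hf (z₁ htop)] with x h1 h2
    tauto
  have hD : ∀ᵐ x ∂volume.restrict (cube d), x ∈ D := by
    rw [H₀.restrict_eq]; exact ae_restrict_mem H₀.measurableSet
  -- Concavity of the determinant root makes the interpolated determinant positive wherever both end
  -- determinants are, so no singular mass appears in between.
  have hz : hStarZero h = ⊤ → μ (degenerateSet D A) = 0 := fun htop => by
    refine H.measure_degenerateSet_eq_zero hf ?_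
    filter_upwards [hpos htop, hD] with x hx hxD
    refine hx.imp_right fun ⟨p₀, p₁⟩ => ?_
    refine lt_of_le_of_ne (H.det_nonneg hxD) fun hcon => ?_
    have hle := hdet x hxD
    have hd0 : ((d : ℝ)⁻¹) ≠ 0 := by
      have : (0 : ℝ) < d := by exact_mod_cast hd
      positivity
    rw [← hcon, Real.zero_rpow hd0] at hle
    have q₀ := mul_pos ha (Real.rpow_pos_of_pos p₀ ((d : ℝ)⁻¹))
    have q₁ := mul_pos hb (Real.rpow_pos_of_pos p₁ ((d : ℝ)⁻¹))
    linarith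
  have hψ : ∀ᵐ x ∂volume.restrict (cube d), lagrangianDensity h A f x
      ≤ a * lagrangianDensity h A₀ f x + b * lagrangianDensity h A₁ f x := by
    have hpos' : ∀ᵐ x ∂volume.restrict (cube d), hStarZero h = ⊤ →
        f x = 0 ∨ 0 < (A₀ x).det ∧ 0 < (A₁ x).det := by
      by_cases htop : hStarZero h = ⊤
      · exact (hpos htop).mono fun _ hx _ => hx
      · exact Eventually.of_forall fun _ hx => absurd hx htop
    filter_upwards [hpos', hD] with x hx hxD
    rcases (hf.nonneg x).eq_or_lt with hfx | hfx
    · simp [lagrangianDensity, ← hfx]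
    · have hn := H.det_nonneg hxD
      have hn₀ := H₀.det_nonneg hxD
      have hn₁ := H₁.det_nonneg hxD
      have key := hStarExt_le_of_rpow_concave hd hMC hconv h0 (m := (A x).det / f x)
        (m₀ := (A₀ x).det / f x) (m₁ := (A₁ x).det / f x) (by positivity) (by positivity)
        (by positivity) ha hb hab ?_ ?_
      · have := mul_le_mul_of_nonneg_left key hfx.le
        simp only [lagrangianDensity]
        linarith
      -- Division of the determinants by `f x` multiplies every root by the same factor, so
      -- concavity is kept.
      · rw [Real.div_rpow hn₀ hfx.le, Real.div_rpow hn₁ hfx.le, Real.div_rpow hn hfx.le,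
          ← mul_div_assoc, ← mul_div_assoc, ← add_div]
        exact div_le_div_of_nonneg_right (hdet x hxD) (Real.rpow_nonneg hfx.le _)
      · intro htop
        have := (hx htop).resolve_left hfx.ne'
        exact ⟨div_pos this.1 hfx, div_pos this.2 hfx⟩
  have hVle : ∀ᵐ x ∂μ, V ((a • t₀ + b • t₁) x)
      ≤ a * V (t₀ x) + b * V (t₁ x) - lam / 2 * (a * b * ‖t₁ x - t₀ x‖ ^ 2) := by
    filter_upwards [H₀.ae_mem hμ] with x hx
    exact hV.le_combination (H₀.mapsTo hx) (H₁.mapsTo hx) ha.le hb.le hab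
  have hsq : Integrable (fun x => ‖t₁ x - t₀ x‖ ^ 2) μ :=
    ((H₁.memLp hμ).sub (H₀.memLp hμ)).integrable_norm_pow (by norm_num)
  have hψi : Integrable (fun x => a * lagrangianDensity h A₀ f x + b * lagrangianDensity h A₁ f x)
      (volume.restrict (cube d)) := (i₀.const_mul a).add (i₁.const_mul b)
  have hVi : Integrable (fun x => a * V (t₀ x) + b * V (t₁ x)
      - lam / 2 * (a * b * ‖t₁ x - t₀ x‖ ^ 2)) μ :=
    ((v₀.const_mul a).add (v₁.const_mul b)).sub ((hsq.const_mul _).const_mul _)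
  -- The interpolated energy is not assumed finite: this follows from the convexity bound above and
  -- the finite negative part.
  have i : IntegrableOn (lagrangianDensity h A f) (cube d) := by
    rw [H.integrableOn_iff hf]
    have hsub : regularSet D A ⊆ cube d := fun x hx => H.subset hx.1
    refine integrable_of_le_integrable
      ((H.aestronglyMeasurable_lagrangianDensity hf hcont).mono_measure
        (Measure.restrict_mono hsub le_rfl)) (H.lintegral_neg_energy_ne_top hf hconv h0)
      (hψi.mono_measure (Measure.restrict_mono hsub le_rfl))
      (ae_restrict_of_ae_restrict_of_subset hsub hψ)
  have v : Integrable (V ∘ (a • t₀ + b • t₁)) μ :=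
    integrable_of_le_integrable (H.aestronglyMeasurable_potential hμ hV)
      (H.lintegral_neg_potential_ne_top hμ hV) hVi hVle
  rw [H.entropy_map_eq_integral hf hconv h0 hV i v hz,
    H₀.entropy_map_eq_integral hf hconv h0 hV i₀ v₀ z₀,
    H₁.entropy_map_eq_integral hf hconv h0 hV i₁ v₁ z₁, ← EReal.coe_mul, ← EReal.coe_mul,
    ← EReal.coe_add, ← EReal.coe_sub, EReal.coe_le_coe_iff]
  have e1 := integral_mono_ae i hψi hψ
  have e2 := integral_mono_ae v hVi hVle
  rw [integral_add (i₀.const_mul a) (i₁.const_mul b), integral_const_mul, integral_const_mul] at e1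
  have e3 : ∫ x, a * V (t₀ x) + b * V (t₁ x) - lam / 2 * (a * b * ‖t₁ x - t₀ x‖ ^ 2) ∂μ
      = a * (∫ x, V (t₀ x) ∂μ) + b * (∫ x, V (t₁ x) ∂μ)
        - lam / 2 * (a * b * ∫ x, ‖t₁ x - t₀ x‖ ^ 2 ∂μ) := by
    have w₀ : Integrable (fun x => a * V (t₀ x)) μ := v₀.const_mul a
    have w₁ : Integrable (fun x => b * V (t₁ x)) μ := v₁.const_mul b
    have w : Integrable (fun x => a * V (t₀ x) + b * V (t₁ x)) μ := w₀.add w₁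
    rw [integral_sub w ((hsq.const_mul _).const_mul _), integral_add w₀ w₁]
    simp only [integral_const_mul]
  rw [e3] at e2
  simp only [Function.comp_apply] at e2
  linarith

end IsTwiceDiffOn

end FokkerPlanck

end

/-! ### The theorem -/

open FokkerPlanck
theorem proposition2p2 (d : ℕ) (hd : 1 ≤ d)
    (P h : ℝ → ℝ) (hP : IsPressure P) (hh : IsEnergyDensity P h) (hMC : McCannCondition d h)
    (lam : ℝ) (V : Space d → ℝ) (hV : IsPotential d lam V)
    (M : ℝ) (ubar : Space d → ℝ) (hu : IsDensity d M ubar)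
    (T : Space d → Space d) (hT : IsDiffPlus d T) :
    FlatConvexOn lam (pushForward d ubar T) (gradPotentials d)
      (fun t => lagrangianEntropy d h V ubar (t ∘ T)) := by
  have hfinite := isFiniteMeasure_pushForward (T := T) hu
  have hμ := pushForward_absolutelyContinuous ubar hT
  have hconv := hh.convexOn hP
  obtain ⟨f, hf⟩ := exists_hasDensity hμ
  have hE : ∀ {t D A}, IsTwiceDiffOn d t D A → lagrangianEntropy d h V ubar (t ∘ T)
      = entropy d h V ((pushForward d ubar T).map t) := fun H => by
    rw [lagrangianEntropy, pushForward_comp ubar hT H.aemeasurable]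
  refine ⟨convex_gradPotentials d, fun t ht => ?_, fun t₀ ht₀ t₁ ht₁ s hs => ?_⟩
  · obtain ⟨D, A, H⟩ := gradPotentials_exists_isTwiceDiffOn ht
    refine ⟨?_, H.memLp hμ⟩
    beta_reduce
    rw [hE H]
    exact H.entropy_map_ne_bot hf hconv hh.zero hV
  · obtain ⟨D, A₀, A₁, H₀, H₁⟩ := exists_common_isTwiceDiffOn ht₀ ht₁
    -- The end points are separate because there `0 * ⊤ = 0`; for `0 < s < 1` an infinite end value
    -- makes the right side infinite.
    rcases hs.1.eq_or_lt with rfl | hs0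
    · simp
    rcases hs.2.eq_or_lt with rfl | hs1
    · simp
    have ha : 0 < 1 - s := sub_pos.2 hs1
    beta_reduce
    rw [hE (H₀.convexCombination H₁ ha.le hs0.le (by ring)), hE H₀, hE H₁]
    have b₀ := H₀.entropy_map_ne_bot hf hconv hh.zero hV
    have b₁ := H₁.entropy_map_ne_bot hf hconv hh.zero hV
    have n₀ : ((1 - s : ℝ) : EReal) * entropy d h V ((pushForward d ubar T).map t₀) ≠ ⊥ :=
      EReal.coe_mul_ne_bot_of_pos ha b₀
    have n₁ : (s : EReal) * entropy d h V ((pushForward d ubar T).map t₁) ≠ ⊥ :=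
      EReal.coe_mul_ne_bot_of_pos hs0 b₁
    by_cases hfin₀ : entropy d h V ((pushForward d ubar T).map t₀) = ⊤
    · rw [hfin₀, EReal.coe_mul_top_of_pos ha, EReal.top_add_of_ne_bot n₁, EReal.top_sub_coe]
      exact le_top
    by_cases hfin₁ : entropy d h V ((pushForward d ubar T).map t₁) = ⊤
    · rw [hfin₁, EReal.coe_mul_top_of_pos hs0, EReal.add_top_of_ne_bot n₀, EReal.top_sub_coe]
      exact le_top
    exact H₀.entropy_convexCombination_le hd H₁ hf hconv hh.continuousOn hh.zero hMC hV ha hs0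
      (by ring) hfin₀ hfin₁
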